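/- **Setting.** Let $d\in\{2,3\}$ and let $\Omega\subset\mathbb R^d$ be a polyhedral domain (open, connected) with a finite conforming partitioning $\mathcal T^h$ into disjoint open simplices $\sigma\subset\Omega$, $\overline\Omega=\bigcup_{\sigma\in\mathcal T^h}\overline\sigma$. The Dirichlet and Neumann parts of the boundary satisfy one of: (i) $\partial_D\Omega=\partial\Omega$, $\partial_N\Omega=\emptyset$; (ii) $\partial_N\Omega=\partial\Omega$, $\partial_D\Omega=\emptyset$; (iii) $\Omega=(-H,H)^d$, $H>0$, $\partial_D\Omega=[-H,H]^{d-1}\times\{H\}$, $\partial_N\Omega=\partial\Omega\setminus\partial_D\Omega$. Let $u_D\in\mathbb R$ be constant. Let $S^h$ be the space of continuous functions on $\overline\Omega$ that are affine on each $\sigma$, $\pi^h$ the nodal interpolation operator into $S^h$, and $$K^h=\{\chi\in S^h:|\chi|\le1\text{ in }\Omega\},\quad S^h_0=\{\chi\in S^h:\chi=0\text{ on }\partial_D\Omega\},\quad S^h_D=\{\chi\in S^h:\chi=\pi^hu_D\text{ on }\partial_D\Omega\}.$$ Let $(\cdot,\cdot)$ be the $L^2(\Omega)$ inner product and, for piecewise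 continuous functions, let $$(\eta_1,\eta_2)^h=\sum_{\sigma\in\mathcal T^h}\frac{|\sigma|}{d+1}\sum_{k=0}^d\ \lim_{\sigma\ni q\to p_k^\sigma}(\eta_1\eta_2)(q),$$ where $p_0^\sigma,\dots,p_d^\sigma$ are the vertices of $\sigma$. **Data.** Let $\vartheta,\rho\ge0$ and $\lambda,\alpha,a,\varepsilon,\mathcal K_\pm>0$; let $b(s)=\frac12(1+s)\mathcal K_++\frac12(1-s)\mathcal K_-$; let $c_\Psi=\int_{-1}^1\sqrt{2\Psi(s)}\,ds$ for the obstacle potential $\Psi(s)=\frac12(1-s^2)$ if $|s|\le1$, $\Psi(s)=\infty$ if $|s|>1$. Let $L\ge1$, let $G_1,\dots,G_L\in\mathbb R^{d\times d}$ be symmetric positive definite, and, with exponent $r=1$, let $$\gamma(p)=\sum_{\ell=1}^L\gamma_\ell(p),\quad\gamma_\ell(p)=(p\cdot G_\ell p)^{1/2},\qquad B_1(q)=\gamma(q)\sum_{\ell=1}^L\gamma_\ell(q)^{-1}G_\ell\ \ (q\neq0),\quad B_1(0)=L\sum_{\ell=1}^LG_\ell .$$ Let $\beta:\mathbb R^d\to\mathbb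 R_{\ge0}$ be positive away from $0$ and positively homogeneous of degree one, and let $\mu(p)=\gamma(p)/\beta(p)$ for $p\ne0$, $\mu(0)=\bar\mu$, where $\min_{p\neq0}\gamma/\beta\le\bar\mu\le\max_{p\ne0}\gamma/\beta$. Let $\varrho=\varrho^++\varrho^-$ with $\varrho^\pm\in C^1(\mathbb R)$, $\varrho\ge0$ on $[-1,1]$, $\int_{-1}^1\varrho=1$, and let $\widehat\varrho(s_0,s_1)=\varrho^+(s_1)+\varrho^-(s_0)$. **Scheme.** Given a time step $\tau_n>0$, $\Phi^{n-1}\in K^h$ and, if $\vartheta>0$, $W^{n-1}\in S^h_D$, find $(\Phi^n,W^n)\in K^h\times S^h_D$ such that for all $\chi\in S^h_0$ $$\vartheta\Bigl(\tfrac{W^n-W^{n-1}}{\tau_n},\chi\Bigr)^h+\lambda\Bigl(\widehat\varrho(\Phi^{n-1},\Phi^n)\tfrac{\Phi^n-\Phi^{n-1}}{\tau_n},\chi\Bigr)^h+\bigl(\pi^h[b(\Phi^{n-1})]\nabla W^n,\nabla\chi\bigr)=0$$ and for all $\chi\in K^h$ $$\varepsilon\tfrac\rho\alpha\Bigl(\mu(\nabla\Phi^{n-1})\tfrac{\Phi^n-\Phi^{n-1}}{\tau_n},\chi-\Phi^n\Bigr)^h+\varepsilon\bigl(B_1(\nabla\Phi^{n-1})\nabla\Phi^n,\nabla[\chi-\Phi^n]\bigr)\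 \ge\ \Bigl(c_\Psi\tfrac a\alpha\widehat\varrho(\Phi^{n-1},\Phi^n)W^n+\varepsilon^{-1}\Phi^{n-1},\chi-\Phi^n\Bigr)^h .$$ **Theorem.** Assume that $$\rho+|(\Phi^{n-1},1)|>0\qquad\text{or}\qquad(|\widehat\varrho(\Phi^{n-1},\chi)|,1)^h>0\quad\text{for all }\chi\in K^h,$$ and that $\varrho^+=0$, or $\vartheta>0$, or $\partial_N\Omega\ne\partial\Omega$. Then there exists a solution $(\Phi^n,W^n)\in K^h\times S^h_D$ of the scheme. -/

import Mathlib

open Set Filter MeasureTheory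
open scoped Topology Gradient ENNReal

noncomputable section

namespace ObstacleScheme

/-- Euclidean space `ℝ^d`. -/
abbrev E (d : ℕ) : Type := EuclideanSpace ℝ (Fin d)

/-! ### Simplicial meshes and piecewise linear finite elements -/

/-- The closed simplex spanned by the vertices of `σ`. -/
def closedCell {d : ℕ} (σ : Affine.Simplex ℝ (E d) d) : Set (E d) :=
  convexHull ℝ (range σ.points)

/-- The open simplex spanned by the vertices of `σ`. -/
def cell {d : ℕ} (σ : Affine.Simplex ℝ (E d) d) : Set (E d) :=
  interior (closedCell σ)

/-- A (conforming) partitioning of `Ω` into finitely many disjoint open simplices whose closures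
cover `closure Ω`; two closed simplices meet only in the hull of their common vertices. -/
structure Mesh {d : ℕ} (Ω : Set (E d)) where
  cells : Finset (Affine.Simplex ℝ (E d) d)
  cell_subset : ∀ σ ∈ cells, cell σ ⊆ Ω
  disjoint : ∀ σ ∈ cells, ∀ σ' ∈ cells, σ ≠ σ' → Disjoint (cell σ) (cell σ')
  cover : closure Ω = ⋃ σ ∈ cells, closedCell σ
  conforming : ∀ σ ∈ cells, ∀ σ' ∈ cells,
    closedCell σ ∩ closedCell σ' ⊆ convexHull ℝ (range σ.points ∩ range σ'.points)

/-- The vertices of a `d`-simplex in `ℝ^d` as an affine basis; its coordinates are the barycentric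
coordinates of the simplex. -/
def vertexBasis {d : ℕ} (σ : Affine.Simplex ℝ (E d) d) : AffineBasis (Fin (d + 1)) ℝ (E d) :=
  ⟨σ.points, σ.independent, σ.span_eq_top (by simp)⟩

/-- The affine function that agrees with `η` at the vertices of `σ`. -/
def localInterp {d : ℕ} (σ : Affine.Simplex ℝ (E d) d) (η : E d → ℝ) : E d →ᵃ[ℝ] ℝ :=
  ∑ k, η (σ.points k) • (vertexBasis σ).coord k

lemma localInterp_apply {d : ℕ} (σ : Affine.Simplex ℝ (E d) d) (η : E d → ℝ) (x : E d) :
    localInterp σ η x = ∑ k, η (σ.points k) * (vertexBasis σ).coord k x := by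
  have h : ∀ s : Finset (Fin (d + 1)),
      (∑ k ∈ s, η (σ.points k) • (vertexBasis σ).coord k) x
        = ∑ k ∈ s, η (σ.points k) * (vertexBasis σ).coord k x := by
    classical
    intro s
    induction s using Finset.induction_on with
    | empty => simp
    | insert k s hk ih => simp [Finset.sum_insert hk, ih]
  exact h _

lemma localInterp_vertex {d : ℕ} (σ : Affine.Simplex ℝ (E d) d) (η : E d → ℝ)
    (k : Fin (d + 1)) : localInterp σ η (σ.points k) = η (σ.points k) := by
  rw [localInterp_apply]
  have : ∀ j, (vertexBasis σ).coord j (σ.points k) = if j = k then 1 else 0 :=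
    fun j => (vertexBasis σ).coord_apply j k
  simp [this]

namespace Mesh

variable {d : ℕ} {Ω : Set (E d)}

/-- The set of nodes (vertices) of the mesh. -/
def nodes (T : Mesh Ω) : Set (E d) := ⋃ σ ∈ T.cells, range σ.points

/-- The finite element space `S^h` of continuous functions on `closure Ω` that are affine on each
simplex. Elements are represented by functions on `ℝ^d`, of which only the restriction to
`closure Ω` is ever used. -/
def Sh (T : Mesh Ω) : Set (E d → ℝ) :=
  {χ | ContinuousOn χ (closure Ω) ∧ ∀ σ ∈ T.cells, ∃ f : E d →ᵃ[ℝ] ℝ, EqOn χ f (cell σ)}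

/-- The set `K^h` of all `χ ∈ S^h` with `|χ| ≤ 1` in `Ω`. -/
def Kh (T : Mesh Ω) : Set (E d → ℝ) := {χ | χ ∈ T.Sh ∧ ∀ x ∈ Ω, |χ x| ≤ 1}

open Classical in
/-- The nodal interpolation operator `π^h`: on each closed simplex of the mesh, `π^h η` is the
affine interpolant of the values of `η` at the vertices (see `interp_eq`, `interp_mem`,
`interp_node`). -/
def interp (T : Mesh Ω) (η : E d → ℝ) (x : E d) : ℝ :=
  if h : ∃ σ ∈ T.cells, x ∈ closedCell σ then localInterp h.choose η x else 0

lemma interp_eq (T : Mesh Ω) (η : E d → ℝ) {σ : Affine.Simplex ℝ (E d) d} (hσ : σ ∈ T.cells)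
    {x : E d} (hx : x ∈ closedCell σ) : T.interp η x = localInterp σ η x := by
  have h : ∃ σ ∈ T.cells, x ∈ closedCell σ := ⟨σ, hσ, hx⟩
  rw [interp, dif_pos h]
  obtain ⟨hτ, hxτ⟩ := h.choose_spec
  generalize h.choose = τ at hτ hxτ ⊢
  have hsub : convexHull ℝ (range τ.points ∩ range σ.points) ⊆
      (localInterp τ η - localInterp σ η) ⁻¹' {0} := by
    apply convexHull_min
    · rintro y ⟨⟨i, rfl⟩, ⟨j, hj⟩⟩
      have h1 := localInterp_vertex τ η i
      have h2 := localInterp_vertex σ η j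
      rw [hj] at h2
      simp [h1, h2]
    · exact (convex_singleton _).affine_preimage _
  have := hsub (T.conforming τ hτ σ hσ ⟨hxτ, hx⟩)
  simpa [sub_eq_zero] using this

lemma interp_node (T : Mesh Ω) (η : E d → ℝ) {p : E d} (hp : p ∈ T.nodes) :
    T.interp η p = η p := by
  simp only [nodes, mem_iUnion] at hp
  obtain ⟨σ, hσ, k, rfl⟩ := hp
  rw [T.interp_eq η hσ (subset_convexHull ℝ _ ⟨k, rfl⟩), localInterp_vertex]

lemma interp_mem (T : Mesh Ω) (η : E d → ℝ) : T.interp η ∈ T.Sh := by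
  constructor
  · rw [T.cover]
    have : (⋃ σ ∈ T.cells, closedCell σ) = ⋃ σ : T.cells, closedCell σ.1 := by
      ext; simp
    rw [this]
    apply (locallyFinite_of_finite _).continuousOn_iUnion
    · intro σ
      exact (finite_range _).isClosed_convexHull ℝ
    · intro σ
      exact (AffineMap.continuous_of_finiteDimensional (localInterp σ.1 η)).continuousOn.congr
        fun x hx => T.interp_eq η σ.2 hx
  · intro σ hσ
    exact ⟨localInterp σ η, fun x hx => T.interp_eq η hσ (interior_subset hx)⟩

/-- `S^h_0`: the functions in `S^h` that vanish on the Dirichlet boundary `D`. -/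
def Sh0 (T : Mesh Ω) (D : Set (E d)) : Set (E d → ℝ) := {χ | χ ∈ T.Sh ∧ ∀ x ∈ D, χ x = 0}

/-- `S^h_D`: the functions in `S^h` that equal `π^h u_D` on the Dirichlet boundary `D`, for
constant boundary data `u_D`. -/
def ShD (T : Mesh Ω) (D : Set (E d)) (uD : ℝ) : Set (E d → ℝ) :=
  {χ | χ ∈ T.Sh ∧ ∀ x ∈ D, χ x = T.interp (fun _ => uD) x}

/-- The discrete semi-inner product `(η₁, η₂)^h` of functions that are piecewise continuous on the
mesh: on each simplex `σ` it is `|σ| / (d + 1)` times the sum of the limits of `η₁ η₂` at the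
vertices, taken from inside `σ`. -/
def lumped (T : Mesh Ω) (η₁ η₂ : E d → ℝ) : ℝ :=
  ∑ σ ∈ T.cells, (volume (cell σ)).toReal / (d + 1) *
    ∑ k, limUnder (𝓝[cell σ] (σ.points k)) (fun x => η₁ x * η₂ x)

end Mesh

/-- The three admissible configurations of the Dirichlet part `D` and the Neumann part `N` of the
boundary of `Ω`: pure Dirichlet, pure Neumann, or a cube `(-H, H)^d` with Dirichlet conditions on
the face `[-H, H]^(d-1) × {H}`. -/
def AdmissibleBoundary {d : ℕ} (Ω D N : Set (E d)) : Prop :=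
  (D = frontier Ω ∧ N = ∅) ∨
  (N = frontier Ω ∧ D = ∅) ∨
  (∃ H : ℝ, 0 < H ∧ Ω = {x | ∀ i, |x i| < H} ∧
    D = {x | (∀ i, |x i| ≤ H) ∧ ∀ i : Fin d, (i : ℕ) + 1 = d → x i = H} ∧ N = frontier Ω \ D)

/-! ### Data of the phase field model -/

/-- Constants and coefficient functions of the phase field model. -/
structure Model (d L : ℕ) where
  /-- the parameter `ϑ` in front of `w_t` -/
  vartheta : ℝ
  /-- the parameter `λ` -/
  lam : ℝ
  /-- the kinetic coefficient `ρ` -/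
  rho : ℝ
  /-- the parameter `α` -/
  alpha : ℝ
  /-- the parameter `a` -/
  a : ℝ
  /-- the diffusivity `𝒦₊` -/
  Kplus : ℝ
  /-- the diffusivity `𝒦₋` -/
  Kminus : ℝ
  /-- the interfacial parameter `ε` -/
  eps : ℝ
  /-- the exponent `r` in the anisotropy -/
  r : ℝ
  /-- the matrices `G_ℓ` in the anisotropy -/
  G : Fin L → Matrix (Fin d) (Fin d) ℝ
  /-- the mobility coefficient `β` -/
  beta : E d → ℝ
  /-- the value `μ̄` of `μ` at the origin -/
  muBar : ℝ
  /-- the implicit part `ϱ⁺` of the shape function -/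
  shapePlus : ℝ → ℝ
  /-- the explicit part `ϱ⁻` of the shape function -/
  shapeMinus : ℝ → ℝ

namespace Model

variable {d L : ℕ}

/-- `γ_ℓ(p) = (p · G_ℓ p)^{1/2}`. -/
def gammaL (M : Model d L) (l : Fin L) (p : E d) : ℝ :=
  √(p.ofLp ⬝ᵥ (M.G l).mulVec p.ofLp)

/-- The anisotropy `γ(p) = (∑_ℓ γ_ℓ(p)^r)^{1/r}`. -/
def gamma (M : Model d L) (p : E d) : ℝ :=
  (∑ l, M.gammaL l p ^ M.r) ^ (1 / M.r)

/-- The ratio `γ_ℓ(p) / γ(p)`, with the convention that it is `1` for `p = 0`. -/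
def ratio (M : Model d L) (l : Fin L) (p : E d) : ℝ :=
  open Classical in if p = 0 then 1 else M.gammaL l p / M.gamma p

/-- The matrix `B_r(q, p)`. -/
def B (M : Model d L) (q p : E d) : Matrix (Fin d) (Fin d) ℝ :=
  open Classical in
  if q = 0 then
    (L : ℝ) ^ (1 / M.r) • ∑ l, M.ratio l p ^ (M.r - 1) • M.G l
  else
    M.gamma q • ∑ l, (M.ratio l p ^ (M.r - 1) * (M.gammaL l q)⁻¹) • M.G l

/-- The coefficient `μ = γ / β`, extended by `μ̄` at the origin. -/
def mu (M : Model d L) (p : E d) : ℝ :=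
  open Classical in if p = 0 then M.muBar else M.gamma p / M.beta p

/-- `b(s) = ½ (1 + s) 𝒦₊ + ½ (1 - s) 𝒦₋`. -/
def b (M : Model d L) (s : ℝ) : ℝ := (1 + s) / 2 * M.Kplus + (1 - s) / 2 * M.Kminus

/-- The shape function `ϱ = ϱ⁺ + ϱ⁻`. -/
def shape (M : Model d L) (s : ℝ) : ℝ := M.shapePlus s + M.shapeMinus s

/-- `ϱ̂(s₀, s₁) = ϱ⁺(s₁) + ϱ⁻(s₀)`. -/
def shapeHat (M : Model d L) (s₀ s₁ : ℝ) : ℝ := M.shapePlus s₁ + M.shapeMinus s₀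

/-- The standing assumptions on the data of the model. -/
structure Admissible (M : Model d L) : Prop where
  vartheta_nonneg : 0 ≤ M.vartheta
  lam_pos : 0 < M.lam
  rho_nonneg : 0 ≤ M.rho
  alpha_pos : 0 < M.alpha
  a_pos : 0 < M.a
  Kplus_pos : 0 < M.Kplus
  Kminus_pos : 0 < M.Kminus
  eps_pos : 0 < M.eps
  one_le_r : 1 ≤ M.r
  L_pos : 0 < L
  G_posDef : ∀ l, (M.G l).PosDef
  beta_nonneg : ∀ p, 0 ≤ M.beta p
  beta_pos : ∀ p, p ≠ 0 → 0 < M.beta p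
  beta_homogeneous : ∀ s : ℝ, 0 < s → ∀ p, M.beta (s • p) = s * M.beta p
  /-- `min_{p ≠ 0} γ(p) / β(p) ≤ μ̄` -/
  muBar_ge : ∃ p, p ≠ 0 ∧ M.gamma p / M.beta p ≤ M.muBar
  /-- `μ̄ ≤ max_{p ≠ 0} γ(p) / β(p)` -/
  muBar_le : ∃ p, p ≠ 0 ∧ M.muBar ≤ M.gamma p / M.beta p
  shapePlus_contDiff : ContDiff ℝ 1 M.shapePlus
  shapeMinus_contDiff : ContDiff ℝ 1 M.shapeMinus
  shape_nonneg : ∀ s ∈ Icc (-1 : ℝ) 1, 0 ≤ M.shape s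
  shape_integral : ∫ s in (-1 : ℝ)..1, M.shape s = 1

end Model

/-- The obstacle potential: `½ (1 - s²)` for `|s| ≤ 1` and `∞` otherwise. -/
def obstaclePotential (s : ℝ) : ℝ≥0∞ :=
  if |s| ≤ 1 then ENNReal.ofReal ((1 - s ^ 2) / 2) else ⊤

/-- The constant `c_Ψ = ∫_{-1}^{1} (2 Ψ(s))^{1/2} ds` of the obstacle potential. -/
def cPsi : ℝ := ∫ s in (-1 : ℝ)..1, √(2 * (obstaclePotential s).toReal)

/-! ### The scheme -/

/-- `(Φ, W) ∈ K^h × S^h_D` solves one time step, of length `τ`, of the finite element scheme with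
the obstacle potential, where `(Φ₀, W₀)` are the values at the previous time level. -/
structure IsSolution {d L : ℕ} {Ω : Set (E d)} (M : Model d L) (T : Mesh Ω) (D : Set (E d))
    (uD τ : ℝ) (Φ₀ W₀ Φ W : E d → ℝ) : Prop where
  mem_Kh : Φ ∈ T.Kh
  mem_ShD : W ∈ T.ShD D uD
  heat : ∀ χ ∈ T.Sh0 D,
    M.vartheta * T.lumped (fun x => (W x - W₀ x) / τ) χ
      + M.lam * T.lumped (fun x => M.shapeHat (Φ₀ x) (Φ x) * ((Φ x - Φ₀ x) / τ)) χ
      + ∫ x in Ω, T.interp (fun y => M.b (Φ₀ y)) x * ((∇ W x).ofLp ⬝ᵥ (∇ χ x).ofLp) = 0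
  phase : ∀ χ ∈ T.Kh,
    T.lumped (fun x => cPsi * (M.a / M.alpha) * M.shapeHat (Φ₀ x) (Φ x) * W x
          + M.eps⁻¹ * Φ₀ x) (fun x => χ x - Φ x)
      ≤ M.eps * (M.rho / M.alpha) *
          T.lumped (fun x => M.mu (∇ Φ₀ x) * ((Φ x - Φ₀ x) / τ)) (fun x => χ x - Φ x)
        + M.eps * ∫ x in Ω, (M.B (∇ Φ₀ x) (∇ Φ x)).mulVec (∇ Φ x).ofLp
            ⬝ᵥ (∇ (fun y => χ y - Φ y) x).ofLp

end ObstacleScheme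

end

/-! In nodal values, `K^h` becomes the cube `[-1, 1]^nodes`. Gradients of finite element functions
are constant on cells, and for `r = 1` the anisotropy matrix depends only on the old gradient. The
scheme is then a variational inequality on the cube, with a bilinear form in the new phase, coupled
to an equation that is linear in the temperature.

If the heat form is definite on the functions vanishing on the Dirichlet part (`ϑ > 0`, or a
nonempty Dirichlet part and a connected domain), the equation determines the temperature as a
continuous function of the phase. Substituting it leaves a variational inequality for a continuous
map on a compact convex set, solvable by Hartman–Stampacchia (`exists_variationalInequality`);
compactness takes the place of coercivity. This is `exists_coupled_solution`.

In the remaining case, pure Neumann conditions with `ϑ = 0`, the heat form has the constants as its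
kernel and testing with `1` gives a solvability constraint on the phase. Since `ϱ⁺ = 0`, its weights
depend only on the old phase, so it cuts a convex slice from the cube. The inequality is solved on
this slice. It extends to the whole cube through a Lagrange multiplier (`exists_multiplier`), which
is absorbed into the additive constant that the heat equation leaves free. This is
`exists_coupled_solution_of_constants`.

Hartman–Stampacchia follows from Brouwer's theorem and the metric projection. Brouwer's theorem
rests on the absence of a `C¹` retraction of a ball onto its sphere: the integral of `det (1 + t
Dg)` over the ball is its volume for small `t`, hence also at `t = 1` because the integrand is
polynomial in `t`, whereas a retraction has zero Jacobian. -/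

noncomputable section

/-! ### Brouwer's fixed point theorem and the Hartman–Stampacchia theorem. -/

namespace FixedPoint

open Polynomial in
/-- `t ↦ det (1 + t A)` is a polynomial function of degree at most the dimension. -/
lemma exists_polynomial_eval_eq_det {V : Type*} [NormedAddCommGroup V] [NormedSpace ℝ V]
    [FiniteDimensional ℝ V] (A : V →L[ℝ] V) :
    ∃ p : ℝ[X], p.natDegree ≤ Module.finrank ℝ V ∧
      ∀ t : ℝ, p.eval t = (ContinuousLinearMap.id ℝ V + t • A).det := by
  let b := Module.finBasis ℝ V
  let m := LinearMap.toMatrix b b (A : V →ₗ[ℝ] V)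
  refine ⟨((X : ℝ[X]) • m.map C + (1 : Matrix _ _ ℝ).map C).det, ?_, fun t => ?_⟩
  · simpa using natDegree_det_X_add_C_le m 1
  · have h1 : (ContinuousLinearMap.id ℝ V + t • A).det =
        LinearMap.det (LinearMap.id + t • (A : V →ₗ[ℝ] V)) := rfl
    rw [h1, ← LinearMap.det_toMatrix b, ← Polynomial.coe_evalRingHom, RingHom.map_det]
    congr 1
    have h2 : LinearMap.toMatrix b b (LinearMap.id + t • (A : V →ₗ[ℝ] V)) = 1 + t • m := by
      rw [map_add, map_smul, LinearMap.toMatrix_id]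
    rw [h2]
    ext i j
    simp only [RingHom.mapMatrix_apply, Matrix.map_apply, Matrix.add_apply, Matrix.smul_apply,
      smul_eq_mul, coe_evalRingHom, eval_add, eval_mul, eval_X, eval_C]
    rw [add_comm]

open Polynomial in
/-- Extrapolation: the value at `1` of a polynomial of bounded degree is an affine combination of
its values at finitely many points of `(0, δ)`. -/
lemma exists_extrapolation_weights (n : ℕ) {δ : ℝ} (hδ : 0 < δ) :
    ∃ (s : Finset ℝ) (w : ℝ → ℝ), (∀ t ∈ s, t ∈ Ioo 0 δ) ∧ ∑ t ∈ s, w t = 1 ∧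
      ∀ p : ℝ[X], p.natDegree ≤ n → p.eval 1 = ∑ t ∈ s, w t * p.eval t := by
  obtain ⟨s, hs, hcard⟩ := (Ioo_infinite hδ).exists_subset_card_eq (n + 1)
  have key : ∀ p : ℝ[X], p.natDegree ≤ n →
      p.eval 1 = ∑ t ∈ s, (Lagrange.basis s id t).eval 1 * p.eval t := by
    intro p hp
    have hdeg : p.degree < s.card := by
      rw [hcard]
      exact lt_of_le_of_lt degree_le_natDegree (by exact_mod_cast Nat.lt_succ_of_le hp)
    conv_lhs => rw [Lagrange.eq_interpolate (injOn_id _) hdeg]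
    rw [Lagrange.interpolate_apply, eval_finsetSum]
    simp [mul_comm]
  refine ⟨s, fun t => (Lagrange.basis s id t).eval 1, fun t ht => hs ht, ?_, key⟩
  simpa using (key 1 (by simp)).symm

variable {V : Type*} [NormedAddCommGroup V] [InnerProductSpace ℝ V]

/-- The metric projection onto a compact convex set. -/
lemma exists_continuous_projection {K : Set V} (hK : IsCompact K) (hKc : Convex ℝ K)
    (hne : K.Nonempty) :
    ∃ P : V → V, Continuous P ∧ (∀ x, P x ∈ K) ∧
      ∀ x, ∀ y ∈ K, inner ℝ (x - P x) (y - P x) ≤ 0 := by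
  have h : ∀ x : V, ∃ v ∈ K, ∀ y ∈ K, inner ℝ (x - v) (y - v) ≤ 0 := by
    intro x
    obtain ⟨v, hv, hmin⟩ := exists_norm_eq_iInf_of_complete_convex hne hK.isComplete hKc x
    exact ⟨v, hv, (norm_eq_iInf_iff_real_inner_le_zero hKc hv).1 hmin⟩
  choose P hP hin using h
  refine ⟨P, ?_, hP, hin⟩
  refine (LipschitzWith.of_dist_le_mul (K := 1) fun x y => ?_).continuous
  have h1 := hin x (P y) (hP y)
  have h2 := hin y (P x) (hP x)
  have h3 : inner ℝ (P x - P y) (P x - P y) ≤ inner ℝ (x - y) (P x - P y) := by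
    have e1 : inner ℝ (x - P x) (P y - P x) = - inner ℝ (x - P x) (P x - P y) := by
      rw [← inner_neg_right, neg_sub]
    have e2 : inner ℝ (P x - P y) (P x - P y) = inner ℝ (x - y) (P x - P y)
        - inner ℝ (x - P x) (P x - P y) + inner ℝ (y - P y) (P x - P y) := by
      rw [← inner_sub_left, ← inner_add_left]; congr 1; abel
    linarith
  have h4 := real_inner_le_norm (x - y) (P x - P y)
  rw [real_inner_self_eq_norm_sq] at h3
  rw [NNReal.coe_one, one_mul, dist_eq_norm, dist_eq_norm]
  rcases (norm_nonneg (P x - P y)).eq_or_lt with h5 | h5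
  · rw [← h5]; positivity
  · nlinarith

/-- A map that is Lipschitz on a ball and vanishes on its boundary sphere extends by zero to a
Lipschitz map. -/
lemma lipschitzWith_extend_zero {g : V → V} {R : ℝ} {C : NNReal}
    (hg : LipschitzOnWith C g (Metric.closedBall 0 R)) (h0 : ∀ x, ‖x‖ = R → g x = 0) :
    LipschitzWith C (indicator (Metric.closedBall 0 R) g) := by
  have cross : ∀ x y : V, ‖x‖ ≤ R → R < ‖y‖ → ‖g x‖ ≤ C * ‖x - y‖ := by
    intro x y hx hy
    -- The segment from `x` to `y` meets the sphere, where `g` vanishes, at a point no farther from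
    -- `x` than `y` is.
    have hc : ContinuousOn (fun t : ℝ => ‖x + t • (y - x)‖) (Icc 0 1) := by fun_prop
    have := intermediate_value_Icc zero_le_one hc
    obtain ⟨t, ht, htR⟩ := this (show R ∈ _ by simpa using ⟨hx, hy.le⟩)
    have h1 := hg.dist_le_mul x (by simpa using hx) (x + t • (y - x)) (by simpa using htR.le)
    rw [h0 _ htR, dist_zero_right, dist_eq_norm] at h1
    refine h1.trans ?_
    gcongr
    rw [show x - (x + t • (y - x)) = t • (x - y) by module, norm_smul, Real.norm_of_nonneg ht.1]
    exact mul_le_of_le_one_left (norm_nonneg _) ht.2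
  refine LipschitzWith.of_dist_le_mul fun x y => ?_
  by_cases hx : x ∈ Metric.closedBall (0 : V) R <;> by_cases hy : y ∈ Metric.closedBall (0 : V) R
  · simpa [hx, hy] using hg.dist_le_mul x hx y hy
  · rw [indicator_of_mem hx, indicator_of_notMem hy, dist_zero_right, dist_eq_norm]
    exact cross x y (by simpa using hx) (by simpa using hy)
  · rw [indicator_of_mem hy, indicator_of_notMem hx, dist_zero_left, dist_eq_norm, norm_sub_rev]
    exact cross y x (by simpa using hy) (by simpa using hx)
  · rw [indicator_of_notMem hx, indicator_of_notMem hy, dist_self]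
    positivity

variable [FiniteDimensional ℝ V]

/-- Small perturbations of the identity that vanish on the sphere map the ball bijectively onto
itself. -/
lemma bijOn_closedBall_add_smul {g : V → V} {R : ℝ} {C : NNReal}
    (hg : LipschitzOnWith C g (Metric.closedBall 0 R)) (h0 : ∀ x, ‖x‖ = R → g x = 0)
    {t : ℝ} (ht0 : 0 ≤ t) (ht : t * C < 1) :
    BijOn (fun x => x + t • g x) (Metric.closedBall 0 R) (Metric.closedBall 0 R) := by
  set B : Set V := Metric.closedBall 0 R
  set f : V → V := fun x => x + t • indicator B g x with hf
  have hlip := lipschitzWith_extend_zero hg h0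
  have happ : ApproximatesLinearOn f ((ContinuousLinearEquiv.refl ℝ V : V ≃L[ℝ] V) : V →L[ℝ] V)
      univ (Real.toNNReal t * C) := by
    intro x _ y _
    have h1 : f x - f y - ((ContinuousLinearEquiv.refl ℝ V : V ≃L[ℝ] V) : V →L[ℝ] V) (x - y)
        = t • (indicator B g x - indicator B g y) := by
      simp only [hf, ContinuousLinearEquiv.coe_refl, ContinuousLinearMap.coe_id', id]
      module
    rw [h1, norm_smul, Real.norm_of_nonneg ht0, NNReal.coe_mul, Real.coe_toNNReal t ht0, mul_assoc]
    gcongr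
    simpa [dist_eq_norm] using hlip.dist_le_mul x y
  have hbij : Function.Bijective f := by
    have hc : Subsingleton V ∨ Real.toNNReal t * C <
        ‖((ContinuousLinearEquiv.refl ℝ V : V ≃L[ℝ] V).symm : V →L[ℝ] V)‖₊⁻¹ := by
      rcases subsingleton_or_nontrivial V with h | h
      · exact Or.inl h
      · right
        have : ‖((ContinuousLinearEquiv.refl ℝ V : V ≃L[ℝ] V).symm : V →L[ℝ] V)‖₊ = 1 := by
          ext
          simp
        rw [this, inv_one, ← NNReal.coe_lt_coe]
        simpa [Real.coe_toNNReal t ht0] using ht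
    exact ⟨injOn_univ.1 (happ.injOn hc), happ.surjective hc⟩
  have hin : ∀ x ∈ B, f x = x + t • g x := fun x hx => by simp [hf, hx]
  have hout : ∀ x ∉ B, f x = x := fun x hx => by simp [hf, hx]
  -- Outside the ball `f` is the identity. If `f x` lay outside, then `f (f x) = f x`, and
  -- injectivity would give `f x = x`.
  have hmaps : MapsTo f B B := by
    intro x hx
    by_contra hfx
    have := hbij.1 (hout _ hfx)
    rw [this] at hfx
    exact hfx hx
  refine BijOn.congr (f₁ := f) ⟨hmaps, hbij.1.injOn, ?_⟩ hin
  intro y hy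
  obtain ⟨x, rfl⟩ := hbij.2 y
  by_cases hx : x ∈ B
  · exact ⟨x, hx, rfl⟩
  · rw [hout x hx] at hy
    exact absurd hy hx

/-- A kernel vector of `1 + s A` with `0 ≤ s ≤ t` would satisfy `‖v‖ ≤ s ‖A‖ ‖v‖ < ‖v‖`. So the
determinant has no zero on `[0, t]` and keeps the sign of its value `1` at `s = 0`. -/
lemma det_id_add_smul_pos {A : V →L[ℝ] V} {t : ℝ} (ht0 : 0 ≤ t) (ht : t * ‖A‖ < 1) :
    0 < (ContinuousLinearMap.id ℝ V + t • A).det := by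
  obtain ⟨p, -, hp⟩ := exists_polynomial_eval_eq_det A
  have hne : ∀ s ∈ Icc 0 t, p.eval s ≠ 0 := by
    intro s hs h0
    rw [hp] at h0
    obtain ⟨v, hv, hv0⟩ := Submodule.exists_mem_ne_zero_of_ne_bot
      (LinearMap.bot_lt_ker_of_det_eq_zero (f := ((ContinuousLinearMap.id ℝ V + s • A :
        V →L[ℝ] V) : V →ₗ[ℝ] V)) h0).ne'
    have hv1 : v = -(s • A v) := by
      have : v + s • A v = 0 := by simpa using hv
      exact eq_neg_of_add_eq_zero_left this
    have : ‖v‖ ≤ s * ‖A‖ * ‖v‖ := by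
      conv_lhs => rw [hv1]
      rw [norm_neg, norm_smul, Real.norm_of_nonneg hs.1, mul_assoc]
      gcongr
      exacts [hs.1, A.le_opNorm v]
    have h2 : s * ‖A‖ < 1 := lt_of_le_of_lt (by gcongr; exact hs.2) ht
    have h3 : 0 < ‖v‖ := norm_pos_iff.2 hv0
    nlinarith
  rw [← hp]
  by_contra! hle
  have hc : ContinuousOn (fun s => p.eval s) (Icc 0 t) := p.continuous.continuousOn
  have h01 : p.eval 0 = 1 := by
    rw [hp]; simp [ContinuousLinearMap.det]
  obtain ⟨s, hs, hs0⟩ := intermediate_value_Icc' ht0 hc (show (0 : ℝ) ∈ _ from ⟨hle, by simp [h01]⟩)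
  exact hne s hs hs0

section

variable [MeasurableSpace V] [BorelSpace V]

/-- The determinant of the derivative of a `C¹` map that fixes the boundary sphere integrates to the
volume of the ball. -/
lemma integral_det_eq_volume {g : V → V} (hg : ContDiff ℝ 1 g) {R : ℝ}
    (h0 : ∀ x, ‖x‖ = R → g x = 0) :
    ∫ x in Metric.closedBall (0 : V) R, (ContinuousLinearMap.id ℝ V + fderiv ℝ g x).det
      = volume.real (Metric.closedBall (0 : V) R) := by
  set B : Set V := Metric.closedBall 0 R
  have hBc : IsCompact B := isCompact_closedBall 0 R
  obtain ⟨C, hC⟩ := hg.contDiffOn.exists_lipschitzOnWith one_ne_zero (convex_closedBall 0 R) hBc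
  have hcont : Continuous (fderiv ℝ g) := hg.continuous_fderiv one_ne_zero
  obtain ⟨D, hD⟩ := hBc.exists_bound_of_continuousOn hcont.continuousOn
  -- Below this `δ` both `t * C < 1`, for bijectivity on the ball, and `t * ‖fderiv ℝ g x‖ < 1`, for
  -- positivity of the Jacobian, hold.
  obtain ⟨s, w, hs, hw, hp⟩ := exists_extrapolation_weights (Module.finrank ℝ V)
    (δ := 1 / (C + |D| + 1)) (by positivity)
  have hsmall : ∀ t ∈ s, ∫ x in B, (ContinuousLinearMap.id ℝ V + t • fderiv ℝ g x).det
      = volume.real B := by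
    intro t ht
    obtain ⟨ht0, ht1⟩ := hs t ht
    rw [lt_div_iff₀ (by positivity)] at ht1
    have hbij := bijOn_closedBall_add_smul hC h0 ht0.le
      (lt_of_le_of_lt (by gcongr; linarith [abs_nonneg D]) ht1)
    have hder : ∀ x ∈ B, HasFDerivWithinAt (fun x => x + t • g x)
        (ContinuousLinearMap.id ℝ V + t • fderiv ℝ g x) B x := fun x _ =>
      ((hasFDerivAt_id x).add
        ((hg.differentiable one_ne_zero x).hasFDerivAt.const_smul t)).hasFDerivWithinAt
    have h1 := integral_image_eq_integral_abs_det_fderiv_smul volume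
      (Metric.isClosed_closedBall.measurableSet) hder hbij.injOn (fun _ => (1 : ℝ))
    rw [hbij.image_eq] at h1
    simp only [smul_eq_mul, mul_one, integral_const, MeasurableSet.univ, measureReal_restrict_apply,
      univ_inter] at h1
    rw [h1]
    refine setIntegral_congr_fun Metric.isClosed_closedBall.measurableSet fun x hx => ?_
    refine (abs_of_pos (det_id_add_smul_pos ht0.le ?_)).symm
    refine lt_of_le_of_lt ?_ ht1
    gcongr
    have := hD x hx
    linarith [le_abs_self D, C.coe_nonneg]
  have hpt : ∀ x, (ContinuousLinearMap.id ℝ V + fderiv ℝ g x).det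
      = ∑ t ∈ s, w t * (ContinuousLinearMap.id ℝ V + t • fderiv ℝ g x).det := by
    intro x
    obtain ⟨p, hdeg, hpe⟩ := exists_polynomial_eval_eq_det (fderiv ℝ g x)
    have := hp p hdeg
    simp only [hpe, one_smul] at this
    exact this
  simp_rw [hpt]
  rw [integral_finsetSum]
  · simp_rw [integral_const_mul]
    rw [Finset.sum_congr rfl fun t ht => by rw [hsmall t ht], ← Finset.sum_mul, hw, one_mul]
  · intro t _
    have hdc : Continuous fun x => (ContinuousLinearMap.id ℝ V + t • fderiv ℝ g x).det :=
      ContinuousLinearMap.continuous_det.comp (by fun_prop)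
    have hint : IntegrableOn _ B volume := hdc.continuousOn.integrableOn_compact hBc
    exact Integrable.const_mul hint _

end

/-- There is no `C¹` retraction of a ball onto its boundary sphere. -/
lemma not_exists_retraction {N : V → V} (hN : ContDiff ℝ 1 N) {R : ℝ} (hR : 0 < R)
    (hnorm : ∀ x, ‖N x‖ = R) (hid : ∀ x, ‖x‖ = R → N x = x) : False := by
  borelize V
  have h := integral_det_eq_volume (g := fun x => N x - x) (hN.sub contDiff_id) (R := R)
    fun x hx => by simp [hid x hx]
  have hder : ∀ x, fderiv ℝ (fun x => N x - x) x = fderiv ℝ N x - ContinuousLinearMap.id ℝ V :=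
    fun x => ((hN.differentiable one_ne_zero x).hasFDerivAt.sub (hasFDerivAt_id x)).fderiv
  -- Since `‖N‖` is constant, the range of the derivative is orthogonal to `N x ≠ 0`, so the
  -- derivative is not surjective.
  have hdet : ∀ x, (fderiv ℝ N x).det = 0 := by
    intro x
    by_contra hne
    have hsurj : Function.Surjective (fderiv ℝ N x) :=
      ((fderiv ℝ N x : V →ₗ[ℝ] V).equivOfDetNeZero hne).surjective
    obtain ⟨v, hv⟩ := hsurj (N x)
    have h1 : HasFDerivAt N (fderiv ℝ N x) x := (hN.differentiable one_ne_zero x).hasFDerivAt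
    have h2 := (h1.inner ℝ h1)
    have h3 : (fun t => inner ℝ (N t) (N t)) = fun _ => R ^ 2 := by
      ext t; rw [real_inner_self_eq_norm_sq, hnorm]
    rw [h3] at h2
    have h4 := congrArg (fun L => L v) (h2.unique (hasFDerivAt_const _ _))
    simp [hv, hnorm] at h4
    exact hR.ne' h4
  simp only [hder, add_sub_cancel, hdet, integral_zero] at h
  have hpos : 0 < volume.real (Metric.closedBall (0 : V) R) :=
    ENNReal.toReal_pos (Metric.measure_closedBall_pos _ _ hR).ne' measure_closedBall_lt_top.ne
  exact hpos.ne h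

open scoped Manifold in
/-- Brouwer's theorem for maps that vanish outside a ball. -/
lemma exists_fixedPoint_of_vanishing {h : V → V} (hc : Continuous h) {r : ℝ} (hr : 0 < r)
    (h0 : ∀ x, r ≤ ‖x‖ → h x = 0) : ∃ x, h x = x := by
  by_contra! hne
  obtain ⟨δ, hδ, hδle⟩ : ∃ δ > 0, ∀ x, δ ≤ ‖x - h x‖ := by
    obtain ⟨x₀, -, hx₀⟩ := (isCompact_closedBall (0 : V) r).exists_isMinOn
      ⟨0, by simp [hr.le]⟩ (f := fun x => ‖x - h x‖) (by fun_prop)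
    refine ⟨min r ‖x₀ - h x₀‖,
      lt_min hr (norm_pos_iff.2 (sub_ne_zero.2 (hne x₀).symm)), fun x => ?_⟩
    rcases le_total r ‖x‖ with hx | hx
    · rw [h0 x hx, sub_zero]; exact (min_le_left _ _).trans hx
    · exact (min_le_right _ _).trans (hx₀ (by simpa using hx))
  -- Convex constraints for a smooth approximation `k` of `h`: closer than the least displacement
  -- `δ`, so that `k` has no fixed point either, and zero from radius `r + 1` on.
  let t : V → Set V := fun x => {y | y ∈ Metric.ball (h x) δ ∧ (r + 1 ≤ ‖x‖ → y ∈ ({0} : Set V))}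
  obtain ⟨k, hk⟩ := exists_contMDiffMap_forall_mem_convex_of_local_const (n := (⊤ : ℕ∞)) 𝓘(ℝ, V) (t := t)
    (fun x => by
      by_cases hx : r + 1 ≤ ‖x‖
      · have : t x = Metric.ball (h x) δ ∩ {0} := by ext; simp [t, hx]
        rw [this]
        exact (convex_ball _ _).inter (convex_singleton _)
      · have : t x = Metric.ball (h x) δ := by ext; simp [t, hx]
        rw [this]
        exact convex_ball _ _)
    (fun x => by
      rcases lt_or_ge ‖x‖ (r + 1) with hx | hx
      · refine ⟨h x, ?_⟩
        filter_upwards [hc.continuousAt.eventually (Metric.ball_mem_nhds (h x) hδ),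
          continuous_norm.continuousAt.eventually (gt_mem_nhds hx)] with y hy1 hy2
        exact ⟨by rw [Metric.mem_ball, dist_comm]; exact hy1, fun h' => absurd hy2 (not_lt.2 h')⟩
      · refine ⟨0, ?_⟩
        filter_upwards [continuous_norm.continuousAt.eventually
          (lt_mem_nhds (show r < ‖x‖ by linarith))] with y hy
        exact ⟨by simp [h0 y (le_of_lt hy), hδ], fun _ => rfl⟩)
  have hkC : ContDiff ℝ 1 (k : V → V) := k.contMDiff.contDiff.of_le (by exact_mod_cast le_top)
  have hf : ContDiff ℝ 1 (fun x => x - k x) := contDiff_id.sub hkC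
  have hf0 : ∀ x, x - k x ≠ 0 := by
    intro x hx
    have h1 := (hk x).1
    rw [← sub_eq_zero.1 hx, Metric.mem_ball, dist_eq_norm] at h1
    exact absurd h1 (not_lt.2 (hδle x))
  have hR : 0 < r + 1 := by linarith
  -- The displacement `x - k x` is rescaled to length `r + 1`; on the sphere of that radius `k`
  -- vanishes, so its points stay fixed.
  refine not_exists_retraction (N := fun x => ((r + 1) * ‖x - k x‖⁻¹) • (x - k x)) ?_ hR ?_ ?_
  · exact (contDiff_const.mul ((hf.norm ℝ hf0).inv fun x => norm_ne_zero_iff.2 (hf0 x))).smul hf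
  · intro x
    have := norm_ne_zero_iff.2 (hf0 x)
    rw [norm_smul, norm_mul, norm_inv, norm_norm, Real.norm_of_nonneg hR.le]
    field_simp
  · intro x hx
    have : k x = 0 := (hk x).2 hx.ge
    simp [this, hx, hR.ne']

/-- The Hartman–Stampacchia theorem. -/
theorem exists_variationalInequality {K : Set V} (hK : IsCompact K) (hKc : Convex ℝ K)
    (hne : K.Nonempty) {F : V → V} (hF : ContinuousOn F K) :
    ∃ x ∈ K, ∀ y ∈ K, 0 ≤ inner ℝ (F x) (y - x) := by
  obtain ⟨P, hPc, hPK, hP⟩ := exists_continuous_projection hK hKc hne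
  obtain ⟨r, hr, hrK⟩ : ∃ r > 0, ∀ x ∈ K, ‖x‖ ≤ r := by
    obtain ⟨r, hr⟩ := hK.exists_bound_of_continuousOn (f := id) continuousOn_id
    exact ⟨|r| + 1, by positivity, fun x hx => (hr x hx).trans (by linarith [le_abs_self r])⟩
  have hFP : Continuous fun x => F (P x) :=
    hF.comp_continuous hPc hPK
  -- The cutoff is `1` for `‖x‖ ≤ r` and `0` for `‖x‖ ≥ r + 1`. Values of `P` have norm at most `r`,
  -- so a fixed point lies where the cutoff is `1`.
  obtain ⟨x, hx⟩ := exists_fixedPoint_of_vanishing (r := r + 1)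
    (h := fun x => (max 0 (min 1 (r + 1 - ‖x‖))) • P (P x - F (P x)))
    (Continuous.smul (by fun_prop) (hPc.comp (hPc.sub hFP)))
    (by linarith) fun x hx => by
      rw [max_eq_left ((min_le_right _ _).trans (by linarith)), zero_smul]
  have hxr : ‖x‖ ≤ r := by
    rw [← hx, norm_smul, Real.norm_of_nonneg (le_max_left _ _)]
    refine (mul_le_of_le_one_left (norm_nonneg _) ?_).trans (hrK _ (hPK _))
    exact max_le zero_le_one (min_le_left _ _)
  rw [min_eq_left (by linarith), max_eq_right zero_le_one, one_smul] at hx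
  have hxK : x ∈ K := hx ▸ hPK _
  have hPx : P x = x := by
    have := hP x x hxK
    rw [real_inner_self_nonpos, sub_eq_zero] at this
    exact this.symm
  rw [hPx] at hx
  refine ⟨x, hxK, fun y hy => ?_⟩
  have := hP (x - F x) y hy
  rw [hx, sub_sub_cancel_left, inner_neg_left] at this
  linarith

end FixedPoint

/-! ### Coupled variational inequalities in coordinates. -/

namespace FixedPoint

variable {ι : Type*} [Fintype ι]

lemma apply_eq_sum_single [DecidableEq ι] (F : (ι → ℝ) →ₗ[ℝ] ℝ) (v : ι → ℝ) :
    F v = ∑ i, v i * F (Pi.single i 1) := by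
  conv_lhs => rw [← Finset.univ_sum_single v]
  rw [map_sum]
  refine Finset.sum_congr rfl fun i _ => ?_
  rw [← smul_eq_mul, ← map_smul, ← Pi.single_smul, smul_eq_mul, mul_one]

/-- The Hartman–Stampacchia theorem in coordinates. -/
lemma exists_variationalInequality_pi {K : Set (ι → ℝ)} (hK : IsCompact K) (hKc : Convex ℝ K)
    (hne : K.Nonempty) (F : (ι → ℝ) → (ι → ℝ) →ₗ[ℝ] ℝ)
    (hF : ∀ v, ContinuousOn (fun x => F x v) K) :
    ∃ x ∈ K, ∀ y ∈ K, 0 ≤ F x (y - x) := by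
  classical
  let e := EuclideanSpace.equiv ι ℝ
  have hK' : e ⁻¹' K = e.symm '' K := by
    rw [ContinuousLinearEquiv.image_symm_eq_preimage]
  obtain ⟨x, hx, hxy⟩ := exists_variationalInequality (K := e ⁻¹' K)
    (F := fun x => e.symm fun i => F (e x) (Pi.single i 1))
    (by rw [hK']; exact hK.image e.symm.continuous)
    (hKc.linear_preimage e.toLinearEquiv.toLinearMap)
    (by rw [hK']; exact hne.image _)
    (by
      refine e.symm.continuous.comp_continuousOn ?_
      exact continuousOn_pi.2 fun i =>
        (hF (Pi.single i 1)).comp e.continuous.continuousOn fun _ h => h)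
  refine ⟨e x, hx, fun y hy => ?_⟩
  have h1 := hxy (e.symm y) (by simpa using hy)
  have h2 : inner ℝ (e.symm fun i => F (e x) (Pi.single i 1)) (e.symm y - x)
      = F (e x) (y - e x) := by
    rw [apply_eq_sum_single (F (e x)) (y - e x), PiLp.inner_apply]
    rfl
  rwa [h2] at h1

/-- A linear functional that is minimal over a slice of the cube has a Lagrange multiplier. -/
lemma exists_multiplier (F : (ι → ℝ) →ₗ[ℝ] ℝ) {ω x : ι → ℝ} (hω : ∀ i, 0 ≤ ω i)
    (hx : x ∈ Icc (-1 : ι → ℝ) 1)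
    (h : ∀ y ∈ Icc (-1 : ι → ℝ) 1, ∑ i, ω i * (y i - x i) = 0 → 0 ≤ F (y - x)) :
    ∃ κ : ℝ, ∀ y ∈ Icc (-1 : ι → ℝ) 1, κ * ∑ i, ω i * (y i - x i) ≤ F (y - x) := by
  classical
  set f : ι → ℝ := fun i => F (Pi.single i 1) with hf
  have hFv : ∀ v, F v = ∑ i, v i * f i := apply_eq_sum_single F
  have hFs : ∀ i c, F (Pi.single i c) = c * f i := by
    intro i c
    simp [hFv, Pi.single_apply]
  have hx1 : ∀ i, -1 ≤ x i := fun i => hx.1 i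
  have hx2 : ∀ i, x i ≤ 1 := fun i => hx.2 i
  -- Coordinates of weight zero can move without affecting the constraint.
  have hup : ∀ i, ω i = 0 → x i < 1 → 0 ≤ f i := by
    intro i hi hxi
    have := h (x + Pi.single i (1 - x i)) ?_ ?_
    · rw [add_sub_cancel_left, hFs] at this
      exact nonneg_of_mul_nonneg_right this (by linarith)
    · constructor <;> intro j <;> by_cases hj : j = i
      · subst hj; simp
      · simp [hj, hx1 j]
      · subst hj; simp
      · simp [hj, hx2 j]
    · refine Finset.sum_eq_zero fun j _ => ?_
      by_cases hj : j = i
      · subst hj; simp [hi]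
      · simp [hj]
  have hdn : ∀ i, ω i = 0 → -1 < x i → f i ≤ 0 := by
    intro i hi hxi
    have := h (x + Pi.single i (-1 - x i)) ?_ ?_
    · rw [add_sub_cancel_left, hFs] at this
      nlinarith
    · constructor <;> intro j <;> by_cases hj : j = i
      · subst hj; simp
      · simp [hj, hx1 j]
      · subst hj; simp
      · simp [hj, hx2 j]
    · refine Finset.sum_eq_zero fun j _ => ?_
      by_cases hj : j = i
      · subst hj; simp [hi]
      · simp [hj]
  -- Raising `x i` by `t * ω j` and lowering `x j` by `t * ω i` preserves the weighted sum, and `t`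
  -- is small enough to stay in the cube.
  have hpair : ∀ j ∈ {j | 0 < ω j ∧ -1 < x j}, ∀ i ∈ {i | 0 < ω i ∧ x i < 1},
      f j / ω j ≤ f i / ω i := by
    rintro j ⟨hj, hxj⟩ i ⟨hi, hxi⟩
    rcases eq_or_ne i j with rfl | hij
    · exact le_rfl
    obtain ⟨t, ht, ht1, ht2⟩ : ∃ t > 0, t * ω j ≤ 1 - x i ∧ t * ω i ≤ x j + 1 := by
      refine ⟨min ((1 - x i) / ω j) ((x j + 1) / ω i), ?_, ?_, ?_⟩
      · exact lt_min (div_pos (by linarith) hj) (div_pos (by linarith) hi)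
      · rw [← le_div_iff₀ hj]; exact min_le_left _ _
      · rw [← le_div_iff₀ hi]; exact min_le_right _ _
    have := h (x + (Pi.single i (t * ω j) - Pi.single j (t * ω i))) ?_ ?_
    · rw [add_sub_cancel_left, map_sub, hFs, hFs] at this
      rw [div_le_div_iff₀ hj hi]
      nlinarith
    · have p1 : 0 ≤ t * ω j := by positivity
      have p2 : 0 ≤ t * ω i := by positivity
      constructor <;> intro k <;> by_cases hki : k = i <;> by_cases hkj : k = j
      · exact absurd (hki.symm.trans hkj) hij
      · subst hki; simp [hkj]; linarith [hx1 k]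
      · subst hkj; simp [hki]; linarith [hx1 k]
      · simp [hki, hkj, hx1 k]
      · exact absurd (hki.symm.trans hkj) hij
      · subst hki; simp [hkj]; linarith [hx1 k]
      · subst hkj; simp [hki]; linarith [hx2 k]
      · simp [hki, hkj, hx2 k]
    · have e1 : ∀ k, ω k * ((x + (Pi.single i (t * ω j) - Pi.single j (t * ω i)) : ι → ℝ) k - x k)
          = (if k = i then ω i * (t * ω j) else 0) - (if k = j then ω j * (t * ω i) else 0) := by
        intro k
        by_cases hki : k = i <;> by_cases hkj : k = j
        · exact absurd (hki.symm.trans hkj) hij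
        · subst hki; simp [hkj]
        · subst hkj; simp [hki]
        · simp [hki, hkj]
      simp only [e1, Finset.sum_sub_distrib, Finset.sum_ite_eq', Finset.mem_univ, if_true]
      ring
  -- By `hpair` some `κ` separates the quotients `f j / ω j` of coordinates that can decrease from
  -- those of coordinates that can increase. If one family is empty, any bound of the finitely many
  -- quotients on the right side serves.
  obtain ⟨κ, hκ1, hκ2⟩ : ∃ κ, (∀ j, 0 < ω j → -1 < x j → f j / ω j ≤ κ) ∧
      ∀ i, 0 < ω i → x i < 1 → κ ≤ f i / ω i := by
    rcases eq_empty_or_nonempty {j | 0 < ω j ∧ -1 < x j} with hS | hS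
    · obtain ⟨κ, hκ⟩ := (finite_range fun i => f i / ω i).bddBelow
      refine ⟨κ, fun j hj hxj => ?_, fun i _ _ => hκ ⟨i, rfl⟩⟩
      exact absurd (show j ∈ {j | 0 < ω j ∧ -1 < x j} from ⟨hj, hxj⟩) (by simp [hS])
    · rcases eq_empty_or_nonempty {i | 0 < ω i ∧ x i < 1} with hT | hT
      · obtain ⟨κ, hκ⟩ := (finite_range fun i => f i / ω i).bddAbove
        refine ⟨κ, fun i _ _ => hκ ⟨i, rfl⟩, fun j hj hxj => ?_⟩
        exact absurd (show j ∈ {j | 0 < ω j ∧ x j < 1} from ⟨hj, hxj⟩) (by simp [hT])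
      · obtain ⟨κ, hκ1, hκ2⟩ := exists_between_of_forall_le (hS.image fun i => f i / ω i)
          (hT.image fun i => f i / ω i) (by
            rintro _ ⟨j, hj, rfl⟩ _ ⟨i, hi, rfl⟩
            exact hpair j hj i hi)
        exact ⟨κ, fun j hj hxj => hκ1 ⟨j, ⟨hj, hxj⟩, rfl⟩, fun i hi hxi => hκ2 ⟨i, ⟨hi, hxi⟩, rfl⟩⟩
  refine ⟨κ, fun y hy => ?_⟩
  rw [hFv, Finset.mul_sum]
  refine Finset.sum_le_sum fun i _ => ?_
  have hy1 : -1 ≤ y i := hy.1 i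
  have hy2 : y i ≤ 1 := hy.2 i
  rw [Pi.sub_apply]
  rcases lt_trichotomy (x i) (y i) with hlt | heq | hgt
  · have : κ * ω i ≤ f i := by
      rcases (hω i).eq_or_lt with h0 | h0
      · rw [← h0, mul_zero]; exact hup i h0.symm (by linarith)
      · rw [← le_div_iff₀ h0]; exact hκ2 i h0 (by linarith)
    nlinarith
  · simp [heq]
  · have : f i ≤ κ * ω i := by
      rcases (hω i).eq_or_lt with h0 | h0
      · rw [← h0, mul_zero]; exact hdn i h0.symm (by linarith)
      · rw [← div_le_iff₀ h0]; exact hκ1 i h0 (by linarith)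
    nlinarith

/-- A variational inequality coupled to a definite linear equation. -/
theorem exists_coupled_solution {K : Set (ι → ℝ)} (hK : IsCompact K) (hKc : Convex ℝ K)
    (hne : K.Nonempty) (V₀ : Submodule ℝ (ι → ℝ)) (A Q : (ι → ℝ) →ₗ[ℝ] (ι → ℝ) →ₗ[ℝ] ℝ)
    (hA : ∀ v ∈ V₀, A v v = 0 → v = 0) (u : ι → ℝ) (ℓ₀ ℓ₁ : (ι → ℝ) →ₗ[ℝ] ℝ)
    {g h : ι → ℝ → ℝ} (hg : ∀ i, Continuous (g i)) (hh : ∀ i, Continuous (h i)) :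
    ∃ x ∈ K, ∃ w ∈ V₀, (∀ χ ∈ V₀, A w χ + ℓ₀ χ + ∑ i, g i (x i) * χ i = 0) ∧
      ∀ χ ∈ K, ∑ i, h i (x i) * (u i + w i) * (χ i - x i) ≤ Q x (χ - x) + ℓ₁ (χ - x) := by
  let A₀ : V₀ →ₗ[ℝ] Module.Dual ℝ V₀ := A.domRestrict₁₂ V₀ V₀
  have hinj : Function.Injective A₀ := by
    rw [← LinearMap.ker_eq_bot, LinearMap.ker_eq_bot']
    intro v hv
    have : A v v = 0 := congrArg (fun L => L v) hv
    exact Subtype.ext (hA v v.2 this)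
  let S : V₀ ≃ₗ[ℝ] Module.Dual ℝ V₀ :=
    LinearEquiv.ofInjectiveOfFinrankEq A₀ hinj (Subspace.dual_finrank_eq).symm
  have hS : ∀ (f : Module.Dual ℝ V₀) (χ : V₀), A (S.symm f) χ = f χ := by
    intro f χ
    have : A₀ (S.symm f) = f := S.apply_symm_apply f
    exact congrArg (fun L => L χ) this
  -- The solution of the linear equation for given `x`. It is affine in the numbers `g i (x i)`,
  -- hence continuous in `x`.
  let w : (ι → ℝ) → ι → ℝ := fun x =>
    -((S.symm (ℓ₀.domRestrict V₀) : V₀) : ι → ℝ)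
      - ∑ i, g i (x i) • ((S.symm ((LinearMap.proj i).domRestrict V₀) : V₀) : ι → ℝ)
  have hwV : ∀ x, w x ∈ V₀ := fun x =>
    V₀.sub_mem (V₀.neg_mem (Subtype.mem _))
      (V₀.sum_mem fun i _ => V₀.smul_mem _ (Subtype.mem _))
  have hw : ∀ x, ∀ χ ∈ V₀, A (w x) χ + ℓ₀ χ + ∑ i, g i (x i) * χ i = 0 := by
    intro x χ hχ
    have h1 := hS (ℓ₀.domRestrict V₀) ⟨χ, hχ⟩
    have h2 := fun i => hS ((LinearMap.proj i).domRestrict V₀) ⟨χ, hχ⟩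
    simp only [w, map_sub, map_neg, map_sum, map_smul, LinearMap.sub_apply, LinearMap.neg_apply,
      LinearMap.sum_apply, LinearMap.smul_apply, h1, h2, smul_eq_mul, LinearMap.domRestrict_apply,
      LinearMap.proj_apply]
    ring
  have hwc : Continuous w := by
    refine continuous_const.sub (continuous_finsetSum _ fun i _ => ?_)
    exact ((hg i).comp (continuous_apply i)).smul continuous_const
  have hwc' : ∀ i, Continuous fun x => w x i := fun i => (continuous_apply i).comp hwc
  obtain ⟨x, hx, hxy⟩ := exists_variationalInequality_pi hK hKc hne
    (fun x => Q x + ℓ₁ - ∑ i, (h i (x i) * (u i + w x i)) • LinearMap.proj i) (fun v => by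
      have hQ : Continuous fun x => Q x v := (Q.flip v).continuous_of_finiteDimensional
      simp only [LinearMap.sub_apply, LinearMap.add_apply, LinearMap.sum_apply,
        LinearMap.smul_apply, LinearMap.proj_apply, smul_eq_mul]
      refine Continuous.continuousOn ((hQ.add continuous_const).sub
        (continuous_finsetSum _ fun i _ => ?_))
      exact (((hh i).comp (continuous_apply i)).mul (continuous_const.add (hwc' i))).mul
        continuous_const)
  refine ⟨x, hx, w x, hwV x, hw x, fun χ hχ => ?_⟩
  have := hxy χ hχ
  simp only [LinearMap.sub_apply, LinearMap.add_apply, LinearMap.sum_apply,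
    LinearMap.smul_apply, LinearMap.proj_apply, smul_eq_mul, Pi.sub_apply] at this
  linarith

/-- A variational inequality on the cube coupled to a linear equation whose operator has the
constants as its kernel; the solvability constraint of the equation is linear. -/
theorem exists_coupled_solution_of_constants (A Q : (ι → ℝ) →ₗ[ℝ] (ι → ℝ) →ₗ[ℝ] ℝ)
    (hA0 : ∀ v, 0 ≤ A v v) (hA : ∀ v, A v v = 0 → ∃ c, v = fun _ => c)
    (hA1 : ∀ v (c : ℝ), A v (fun _ => c) = 0) (hA1' : ∀ v (c : ℝ), A (fun _ => c) v = 0)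
    (ℓ₁ : (ι → ℝ) →ₗ[ℝ] ℝ) {x₀ ω : ι → ℝ} (hx₀ : x₀ ∈ Icc (-1 : ι → ℝ) 1) (hω : ∀ i, 0 ≤ ω i)
    (k : ℝ) {c : ℝ} (hc : c ≠ 0) :
    ∃ x ∈ Icc (-1 : ι → ℝ) 1, ∃ w : ι → ℝ,
      (∀ χ, A w χ + ∑ i, k * ω i * (x i - x₀ i) * χ i = 0) ∧
      ∀ χ ∈ Icc (-1 : ι → ℝ) 1,
        ∑ i, c * ω i * w i * (χ i - x i) ≤ Q x (χ - x) + ℓ₁ (χ - x) := by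
  let s : (ι → ℝ) →ₗ[ℝ] ℝ := ∑ i, LinearMap.proj i
  have hs : ∀ v, s v = ∑ i, v i := fun v => by simp [s]
  let wt : (ι → ℝ) →ₗ[ℝ] ℝ := ∑ i, ω i • LinearMap.proj i
  have hwt : ∀ v, wt v = ∑ i, ω i * v i := fun v => by simp [wt]
  let K : Set (ι → ℝ) := Icc (-1) 1 ∩ wt ⁻¹' {wt x₀}
  have hK : IsCompact K := isCompact_Icc.inter_right
    (isClosed_singleton.preimage wt.continuous_of_finiteDimensional)
  have hKc : Convex ℝ K := (convex_Icc _ _).inter ((convex_singleton _).linear_preimage wt)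
  -- The rank-one term `s ⊗ s` makes the form definite, since `s` is nonzero on nonzero constants.
  -- On the slice `K` the solvability constraint holds, and testing with `1` then shows `s w = 0`,
  -- so this term drops out again.
  obtain ⟨x, ⟨hx, hxw⟩, w, -, h1, h2⟩ := exists_coupled_solution hK hKc ⟨x₀, hx₀, rfl⟩ ⊤
    (A + s.smulRight s) Q (fun v _ hv => by
      simp only [LinearMap.add_apply, LinearMap.smulRight_apply, LinearMap.smul_apply,
        smul_eq_mul] at hv
      have h3 := hA0 v
      have h4 := mul_self_nonneg (s v)
      obtain ⟨c, rfl⟩ := hA v (by linarith)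
      have h5 : s (fun _ => c) = 0 := mul_self_eq_zero.1 (by linarith)
      rw [hs] at h5
      ext i
      have : Nonempty ι := ⟨i⟩
      simpa using h5) 0 0 ℓ₁ (g := fun i y => k * ω i * (y - x₀ i)) (h := fun i _ => c * ω i)
    (fun i => by fun_prop) (fun i => by fun_prop)
  simp only [Submodule.mem_top, LinearMap.add_apply, LinearMap.smulRight_apply,
    LinearMap.smul_apply, smul_eq_mul, LinearMap.zero_apply, add_zero, forall_const,
    Pi.zero_apply, zero_add] at h1 h2
  have hxw' : ∑ i, ω i * (x i - x₀ i) = 0 := by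
    have : wt x = wt x₀ := hxw
    rw [hwt, hwt] at this
    simp [mul_sub, this]
  have hsw : ∀ χ, s w * s χ = 0 := by
    intro χ
    rcases isEmpty_or_nonempty ι with hι | hι
    · simp [hs]
    · have h3 := h1 fun _ => 1
      simp only [hA1, mul_one, mul_assoc k, ← Finset.mul_sum, hxw', mul_zero, add_zero,
        zero_add] at h3
      rw [hs (fun _ => 1)] at h3
      have : s w = 0 := by simpa using h3
      simp [this]
  obtain ⟨κ, hκ⟩ := exists_multiplier
    (Q x + ℓ₁ - ∑ i, (c * ω i * w i) • LinearMap.proj i) hω hx (fun y hy hyw => by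
      have := h2 y ⟨hy, by
        have e : ∑ i, ω i * (y i - x i) = wt y - wt x := by
          rw [hwt, hwt, ← Finset.sum_sub_distrib]
          exact Finset.sum_congr rfl fun i _ => by ring
        rw [e, sub_eq_zero] at hyw
        exact hyw.trans hxw⟩
      simpa using this)
  -- `A` does not see the added constant, while in the inequality it contributes exactly the
  -- multiplier term `κ * ∑ i, ω i * (χ i - x i)`.
  refine ⟨x, hx, fun i => w i + κ / c, fun χ => ?_, fun χ hχ => ?_⟩
  · have e : (fun i => w i + κ / c) = w + fun _ => κ / c := rfl
    rw [e, map_add, LinearMap.add_apply, hA1', add_zero]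
    have := h1 χ
    rwa [hsw, add_zero] at this
  · have h3 := hκ χ hχ
    simp only [LinearMap.sub_apply, LinearMap.add_apply, LinearMap.sum_apply,
      LinearMap.smul_apply, LinearMap.proj_apply, smul_eq_mul, Pi.sub_apply] at h3
    have e : ∑ i, c * ω i * (w i + κ / c) * (χ i - x i)
        = ∑ i, c * ω i * w i * (χ i - x i) + κ * ∑ i, ω i * (χ i - x i) := by
      rw [Finset.mul_sum, ← Finset.sum_add_distrib]
      refine Finset.sum_congr rfl fun i _ => ?_
      field_simp
    rw [e]
    linarith

end FixedPoint

/-! ### Geometry of a single simplex. -/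

namespace ObstacleScheme

section Cell

variable {d : ℕ} (σ : Affine.Simplex ℝ (E d) d)

lemma cell_eq_setOf_coord_pos : cell σ = {x | ∀ k, 0 < (vertexBasis σ).coord k x} :=
  (vertexBasis σ).interior_convexHull

lemma isCompact_closedCell : IsCompact (closedCell σ) :=
  (finite_range _).isCompact_convexHull ℝ

lemma convex_closedCell : Convex ℝ (closedCell σ) := convex_convexHull ℝ _

lemma vertex_mem_closedCell (k : Fin (d + 1)) : σ.points k ∈ closedCell σ :=
  subset_convexHull ℝ _ ⟨k, rfl⟩

lemma isOpen_cell : IsOpen (cell σ) := isOpen_interior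

lemma cell_subset_closedCell : cell σ ⊆ closedCell σ := interior_subset

lemma cell_nonempty : (cell σ).Nonempty :=
  ⟨_, (vertexBasis σ).centroid_mem_interior_convexHull⟩

lemma closure_cell : closure (cell σ) = closedCell σ := by
  rw [cell, (convex_closedCell σ).closure_interior_eq_closure_of_nonempty_interior
    (cell_nonempty σ), (isCompact_closedCell σ).isClosed.closure_eq]

/-- Makes limits at a vertex from inside the cell unique, so that `limUnder` in the lumped product
can be evaluated. -/
lemma neBot_nhdsWithin_cell (k : Fin (d + 1)) : (𝓝[cell σ] (σ.points k)).NeBot :=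
  mem_closure_iff_nhdsWithin_neBot.1 (closure_cell σ ▸ vertex_mem_closedCell σ k)

lemma volume_cell_lt_top : volume (cell σ) < ∞ :=
  (measure_mono (cell_subset_closedCell σ)).trans_lt (isCompact_closedCell σ).measure_lt_top

lemma volume_cell_pos : 0 < (volume (cell σ)).toReal :=
  ENNReal.toReal_pos ((isOpen_cell σ).measure_pos _ (cell_nonempty σ)).ne'
    (volume_cell_lt_top σ).ne

/-- The gradient of a barycentric coordinate. -/
def coordGrad (k : Fin (d + 1)) : E d :=
  (InnerProductSpace.toDual ℝ (E d)).symm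
    (LinearMap.toContinuousLinearMap ((vertexBasis σ).coord k).linear)

lemma inner_coordGrad (k : Fin (d + 1)) (v : E d) :
    inner ℝ (coordGrad σ k) v = ((vertexBasis σ).coord k).linear v := by
  rw [coordGrad, InnerProductSpace.toDual_symm_apply]
  rfl

lemma coord_sub_coord (k : Fin (d + 1)) (x y : E d) :
    (vertexBasis σ).coord k x - (vertexBasis σ).coord k y = inner ℝ (coordGrad σ k) (x - y) := by
  rw [inner_coordGrad]
  exact (((vertexBasis σ).coord k).linearMap_vsub x y).symm

lemma hasGradientAt_sum_coord (v : Fin (d + 1) → ℝ) (x : E d) :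
    HasGradientAt (fun y => ∑ k, v k * (vertexBasis σ).coord k y) (∑ k, v k • coordGrad σ k) x := by
  rw [hasGradientAt_iff_hasFDerivAt]
  have h : ∀ y, ∑ k, v k * (vertexBasis σ).coord k y
      = InnerProductSpace.toDual ℝ (E d) (∑ k, v k • coordGrad σ k) y
        + ∑ k, v k * (vertexBasis σ).coord k 0 := by
    intro y
    rw [InnerProductSpace.toDual_apply_apply, sum_inner, ← Finset.sum_add_distrib]
    refine Finset.sum_congr rfl fun k _ => ?_
    have := coord_sub_coord σ k y 0
    rw [sub_zero] at this
    rw [real_inner_smul_left, ← this]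
    ring
  rw [funext h]
  exact (ContinuousLinearMap.hasFDerivAt _).add_const _

lemma continuous_coord (k : Fin (d + 1)) : Continuous fun x => (vertexBasis σ).coord k x :=
  AffineMap.continuous_of_finiteDimensional _

lemma coord_nonneg_of_mem {x : E d} (hx : x ∈ closedCell σ) (k : Fin (d + 1)) :
    0 ≤ (vertexBasis σ).coord k x := by
  rw [← closure_cell, cell_eq_setOf_coord_pos] at hx
  have : x ∈ closure {x | 0 ≤ (vertexBasis σ).coord k x} :=
    closure_mono (fun y hy => (hy k).le) hx
  rwa [(isClosed_le continuous_const (continuous_coord σ k)).closure_eq] at this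

end Cell

/-! ### Nodal values of finite element functions. -/

namespace Mesh

variable {d : ℕ} {Ω : Set (E d)} (T : Mesh Ω)

instance finite_nodes : Finite T.nodes :=
  (T.cells.finite_toSet.biUnion fun _ _ => finite_range _).to_subtype

instance fintypeNodes : Fintype T.nodes := Fintype.ofFinite _

variable {T}

/-- The `k`-th vertex of a mesh cell, as a node. -/
def vertex (σ : T.cells) (k : Fin (d + 1)) : T.nodes :=
  ⟨σ.1.points k, by simp only [nodes, mem_iUnion]; exact ⟨σ.1, σ.2, k, rfl⟩⟩

@[simp] lemma coe_vertex (σ : T.cells) (k : Fin (d + 1)) :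
    (vertex σ k : E d) = σ.1.points k := rfl

lemma exists_eq_vertex (i : T.nodes) : ∃ σ k, i = vertex (T := T) σ k := by
  obtain ⟨p, hp⟩ := i
  simp only [nodes, mem_iUnion] at hp
  obtain ⟨σ, hσ, k, rfl⟩ := hp
  exact ⟨⟨σ, hσ⟩, k, rfl⟩

variable (T)

lemma closedCell_subset (σ : T.cells) : closedCell σ.1 ⊆ closure Ω := by
  rw [T.cover]
  exact subset_biUnion_of_mem (u := fun σ => closedCell σ) σ.2

lemma exists_mem_closedCell {x : E d} (hx : x ∈ closure Ω) : ∃ σ : T.cells, x ∈ closedCell σ.1 := by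
  rw [T.cover] at hx
  simp only [mem_iUnion] at hx
  obtain ⟨σ, hσ, h⟩ := hx
  exact ⟨⟨σ, hσ⟩, h⟩

lemma isCompact_closure (T : Mesh Ω) : IsCompact (closure Ω) := by
  rw [T.cover]
  exact T.cells.isCompact_biUnion fun σ _ => isCompact_closedCell σ

lemma node_mem_closure (i : T.nodes) : (i : E d) ∈ closure Ω := by
  obtain ⟨σ, k, rfl⟩ := exists_eq_vertex i
  exact T.closedCell_subset σ (vertex_mem_closedCell σ.1 k)

open Classical in
/-- The finite element function with prescribed nodal values. -/
def ofNodal (v : T.nodes → ℝ) : E d → ℝ :=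
  T.interp fun x => if h : x ∈ T.nodes then v ⟨x, h⟩ else 0

lemma ofNodal_mem (v : T.nodes → ℝ) : T.ofNodal v ∈ T.Sh := T.interp_mem _

@[simp] lemma ofNodal_node (v : T.nodes → ℝ) (i : T.nodes) : T.ofNodal v i = v i := by
  rw [ofNodal, T.interp_node _ i.2, dif_pos i.2]

variable {T}

lemma ofNodal_apply (v : T.nodes → ℝ) (σ : T.cells) {x : E d} (hx : x ∈ closedCell σ.1) :
    T.ofNodal v x = ∑ k, v (vertex σ k) * (vertexBasis σ.1).coord k x := by
  rw [ofNodal, T.interp_eq _ σ.2 hx, localInterp_apply]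
  refine Finset.sum_congr rfl fun k _ => ?_
  have h : σ.1.points k ∈ T.nodes := (vertex σ k).2
  rw [dif_pos h]
  rfl

/-- A finite element function is the barycentric interpolant of its nodal values. -/
lemma eq_sum_coord {χ : E d → ℝ} (hχ : χ ∈ T.Sh) (σ : T.cells) {x : E d}
    (hx : x ∈ closedCell σ.1) : χ x = ∑ k, χ (σ.1.points k) * (vertexBasis σ.1).coord k x := by
  obtain ⟨f, hf⟩ := hχ.2 σ.1 σ.2
  have hfc : EqOn χ f (closedCell σ.1) := by
    rw [← closure_cell]
    refine hf.of_subset_closure ?_ (AffineMap.continuous_of_finiteDimensional f).continuousOn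
      subset_closure subset_rfl
    rw [closure_cell]
    exact hχ.1.mono (T.closedCell_subset σ)
  rw [hfc hx]
  have h1 : f x = ∑ k, (vertexBasis σ.1).coord k x * f (σ.1.points k) := by
    conv_lhs => rw [← (vertexBasis σ.1).affineCombination_coord_eq_self x]
    rw [Finset.map_affineCombination _ _ _ ((vertexBasis σ.1).sum_coord_apply_eq_one x),
      Finset.affineCombination_eq_linear_combination _ _ _
        ((vertexBasis σ.1).sum_coord_apply_eq_one x)]
    rfl
  rw [h1]
  refine Finset.sum_congr rfl fun k _ => ?_
  rw [hfc (vertex_mem_closedCell σ.1 k), mul_comm]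

lemma eq_ofNodal {χ : E d → ℝ} (hχ : χ ∈ T.Sh) {x : E d} (hx : x ∈ closure Ω) :
    χ x = T.ofNodal (fun i => χ i) x := by
  obtain ⟨σ, hσ⟩ := T.exists_mem_closedCell hx
  rw [eq_sum_coord hχ σ hσ, ofNodal_apply _ σ hσ]
  rfl

lemma sub_mem_Sh {χ η : E d → ℝ} (hχ : χ ∈ T.Sh) (hη : η ∈ T.Sh) :
    (fun x => χ x - η x) ∈ T.Sh := by
  refine ⟨hχ.1.sub hη.1, fun σ hσ => ?_⟩
  obtain ⟨f, hf⟩ := hχ.2 σ hσ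
  obtain ⟨g, hg⟩ := hη.2 σ hσ
  exact ⟨f - g, fun x hx => by simp [hf hx, hg hx]⟩

lemma const_mem_Sh (c : ℝ) : (fun _ => c) ∈ T.Sh :=
  ⟨continuousOn_const, fun _ _ => ⟨AffineMap.const ℝ _ c, fun _ _ => rfl⟩⟩

/-- Membership in `K^h` bounds `χ` only on the open set `Ω`, while nodes may lie on its boundary;
continuity carries the bound over. -/
lemma abs_le_one_of_mem_Kh {χ : E d → ℝ} (hχ : χ ∈ T.Kh) {x : E d} (hx : x ∈ closure Ω) :
    |χ x| ≤ 1 := by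
  have h1 : ContinuousWithinAt χ Ω x := (hχ.1.1 x hx).mono subset_closure
  have h2 := h1.mem_closure hx (t := {y | |y| ≤ 1}) hχ.2
  rwa [(isClosed_le continuous_abs continuous_const).closure_eq] at h2

lemma nodal_mem_Icc {χ : E d → ℝ} (hχ : χ ∈ T.Kh) :
    (fun i : T.nodes => χ i) ∈ Icc (-1 : T.nodes → ℝ) 1 :=
  ⟨fun i => (abs_le.1 (abs_le_one_of_mem_Kh hχ (T.node_mem_closure i))).1,
    fun i => (abs_le.1 (abs_le_one_of_mem_Kh hχ (T.node_mem_closure i))).2⟩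

/-- Values on a cell are convex combinations of the nodal values. Together with `nodal_mem_Icc` this
identifies `K^h` with the cube. -/
lemma ofNodal_mem_Kh {v : T.nodes → ℝ} (hv : v ∈ Icc (-1 : T.nodes → ℝ) 1) :
    T.ofNodal v ∈ T.Kh := by
  refine ⟨T.ofNodal_mem v, fun x hx => ?_⟩
  obtain ⟨σ, hσ⟩ := T.exists_mem_closedCell (subset_closure hx)
  rw [ofNodal_apply v σ hσ]
  calc |∑ k, v (vertex σ k) * (vertexBasis σ.1).coord k x|
      ≤ ∑ k, |v (vertex σ k) * (vertexBasis σ.1).coord k x| := Finset.abs_sum_le_sum_abs _ _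
    _ ≤ ∑ k, (vertexBasis σ.1).coord k x := by
        refine Finset.sum_le_sum fun k _ => ?_
        have h0 := coord_nonneg_of_mem σ.1 hσ k
        rw [abs_mul, abs_of_nonneg h0]
        exact mul_le_of_le_one_left h0 (abs_le.2 ⟨hv.1 _, hv.2 _⟩)
    _ = 1 := (vertexBasis σ.1).sum_coord_apply_eq_one x

/-! ### Gradients -/

/-- The gradient on a cell of the finite element function with given nodal values. -/
def cellGrad (σ : T.cells) : (T.nodes → ℝ) →ₗ[ℝ] E d :=
  ∑ k, (LinearMap.proj (vertex σ k)).smulRight (coordGrad σ.1 k)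

lemma cellGrad_apply (σ : T.cells) (v : T.nodes → ℝ) :
    cellGrad σ v = ∑ k, v (vertex σ k) • coordGrad σ.1 k := by
  simp [cellGrad]

lemma gradient_eq_cellGrad {χ : E d → ℝ} (hχ : χ ∈ T.Sh) (σ : T.cells) {x : E d}
    (hx : x ∈ cell σ.1) : ∇ χ x = cellGrad σ fun i => χ i := by
  have h := hasGradientAt_sum_coord σ.1 (fun k => χ (σ.1.points k)) x
  rw [cellGrad_apply]
  refine HasGradientAt.gradient (h.congr_of_eventuallyEq ?_)
  filter_upwards [(isOpen_cell σ.1).mem_nhds hx] with y hy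
  exact eq_sum_coord hχ σ (cell_subset_closedCell _ hy)

lemma cellGrad_const (σ : T.cells) (c : ℝ) : cellGrad σ (fun _ => c) = 0 := by
  obtain ⟨x, hx⟩ := cell_nonempty σ.1
  rw [← gradient_eq_cellGrad (const_mem_Sh c) σ hx]
  exact gradient_fun_const x c

/-- Nodal values with vanishing gradient are constant if the domain is connected. -/
lemma exists_const_of_cellGrad_eq_zero (hΩ : IsConnected Ω) {v : T.nodes → ℝ}
    (hv : ∀ σ : T.cells, cellGrad σ v = 0) : ∃ c, v = fun _ => c := by
  have hcell : ∀ σ : T.cells, ∀ x ∈ closedCell σ.1, T.ofNodal v x = v (vertex σ 0) := by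
    intro σ x hx
    have h0 := vertex_mem_closedCell σ.1 0
    have h1 : T.ofNodal v x - T.ofNodal v (σ.1.points 0) = inner ℝ (cellGrad σ v)
        (x - σ.1.points 0) := by
      rw [ofNodal_apply v σ hx, ofNodal_apply v σ h0, cellGrad_apply, sum_inner,
        ← Finset.sum_sub_distrib]
      refine Finset.sum_congr rfl fun k _ => ?_
      rw [real_inner_smul_left, ← coord_sub_coord]
      ring
    rw [hv, inner_zero_left, sub_eq_zero] at h1
    rw [h1, ← coe_vertex, ofNodal_node]
  -- Being constant on each closed cell, the function takes finitely many values on the connected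
  -- set `closure Ω`, hence only one. No adjacency of cells is needed.
  have himg : T.ofNodal v '' closure Ω ⊆ range fun σ : T.cells => v (vertex σ 0) := by
    rintro _ ⟨x, hx, rfl⟩
    obtain ⟨σ, hσ⟩ := T.exists_mem_closedCell hx
    exact ⟨σ, (hcell σ x hσ).symm⟩
  have hpre : IsPreconnected (T.ofNodal v '' closure Ω) :=
    hΩ.isPreconnected.closure.image _ (T.ofNodal_mem v).1
  have hsub : (T.ofNodal v '' closure Ω).Subsingleton := by
    by_contra hnt
    exact hpre.infinite_of_nontrivial (not_subsingleton_iff.1 hnt) ((finite_range _).subset himg)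
  obtain ⟨x, hx⟩ := hΩ.nonempty
  refine ⟨T.ofNodal v x, funext fun i => ?_⟩
  rw [← T.ofNodal_node v i]
  exact hsub ⟨i, T.node_mem_closure i, rfl⟩ ⟨x, subset_closure hx, rfl⟩

/-! ### Mass lumping -/

/-- The weight of the vertices of a cell in the lumped product. -/
def vertexWeight (σ : T.cells) : ℝ := (volume (cell σ.1)).toReal / (d + 1)

lemma vertexWeight_pos (σ : T.cells) : 0 < vertexWeight σ :=
  div_pos (volume_cell_pos σ.1) (by positivity)

lemma lumped_eq_sum {η₁ η₂ : E d → ℝ} {f : T.cells → Fin (d + 1) → ℝ}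
    (h : ∀ σ k, Tendsto (fun x => η₁ x * η₂ x) (𝓝[cell σ.1] (σ.1.points k)) (𝓝 (f σ k))) :
    T.lumped η₁ η₂ = ∑ σ, vertexWeight σ * ∑ k, f σ k := by
  rw [lumped, ← Finset.sum_coe_sort]
  refine Finset.sum_congr rfl fun σ _ => ?_
  rw [vertexWeight]
  congr 1
  refine Finset.sum_congr rfl fun k _ => ?_
  have := neBot_nhdsWithin_cell σ.1 k
  exact (h σ k).limUnder_eq

open Classical in
/-- The weight of a node in the lumped product. -/
def mass (i : T.nodes) : ℝ := ∑ σ : T.cells, vertexWeight σ * ∑ k, if vertex σ k = i then 1 else 0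

lemma mass_pos (i : T.nodes) : 0 < mass i := by
  classical
  obtain ⟨σ, k, hi⟩ := exists_eq_vertex i
  refine Finset.sum_pos' (fun τ _ => mul_nonneg (vertexWeight_pos τ).le
    (Finset.sum_nonneg fun k _ => by split_ifs <;> simp)) ⟨σ, Finset.mem_univ _, ?_⟩
  refine mul_pos (vertexWeight_pos σ) (Finset.sum_pos' (fun k _ => by split_ifs <;> simp)
    ⟨k, Finset.mem_univ _, ?_⟩)
  simp [hi]

lemma sum_mass_mul (f : T.nodes → ℝ) :
    ∑ i, mass i * f i = ∑ σ : T.cells, vertexWeight σ * ∑ k, f (vertex σ k) := by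
  classical
  simp only [mass, Finset.sum_mul, mul_assoc]
  rw [Finset.sum_comm]
  refine Finset.sum_congr rfl fun σ _ => ?_
  rw [← Finset.mul_sum, Finset.sum_comm]
  simp

/-- Finite element functions tend to their nodal values. -/
lemma tendsto_vertex {χ : E d → ℝ} (hχ : ContinuousOn χ (closure Ω)) (σ : T.cells)
    (k : Fin (d + 1)) :
    Tendsto χ (𝓝[cell σ.1] (σ.1.points k)) (𝓝 (χ (vertex σ k))) :=
  (hχ _ (T.node_mem_closure (vertex σ k))).mono_left
    (nhdsWithin_mono _ ((cell_subset_closedCell _).trans (T.closedCell_subset σ)))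

/-- For continuous factors the limit at a vertex is the same from every adjacent cell, so the
weights of those cells add up to the mass of the node. -/
lemma lumped_eq_sum_mass {η₁ η₂ : E d → ℝ} (h₁ : ContinuousOn η₁ (closure Ω))
    (h₂ : ContinuousOn η₂ (closure Ω)) :
    T.lumped η₁ η₂ = ∑ i : T.nodes, mass i * (η₁ i * η₂ i) := by
  refine Eq.trans ?_ (sum_mass_mul fun i : T.nodes => η₁ i * η₂ i).symm
  exact lumped_eq_sum fun σ k => (tendsto_vertex h₁ σ k).mul (tendsto_vertex h₂ σ k)

/-! ### Integration -/

/-- What the open cells miss lies in the frontiers of finitely many convex sets, which are null. -/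
lemma ae_eq_iUnion_cell : Ω =ᵐ[volume] ⋃ σ : T.cells, cell σ.1 := by
  refine (ae_eq_set).2 ⟨?_, ?_⟩
  · have hsub : Ω \ (⋃ σ : T.cells, cell σ.1) ⊆ ⋃ σ : T.cells, frontier (closedCell σ.1) := by
      rintro x ⟨hx, hxn⟩
      obtain ⟨σ, hσ⟩ := T.exists_mem_closedCell (subset_closure hx)
      refine mem_iUnion.2 ⟨σ, subset_closure hσ, fun h => hxn (mem_iUnion.2 ⟨σ, h⟩)⟩
    exact measure_mono_null hsub
      (measure_iUnion_null fun σ => (convex_closedCell σ.1).addHaar_frontier volume)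
  · have hsub : (⋃ σ : T.cells, cell σ.1) ⊆ Ω := iUnion_subset fun σ => T.cell_subset σ.1 σ.2
    rw [sdiff_eq_empty.2 hsub, measure_empty]

/-- Gradients are known only inside the cells. Continuity of each `G σ` up to the compact closed
cell supplies integrability. -/
lemma setIntegral_eq_sum {F : E d → ℝ} {G : T.cells → E d → ℝ}
    (hFG : ∀ σ, EqOn F (G σ) (cell σ.1)) (hG : ∀ σ, ContinuousOn (G σ) (closedCell σ.1)) :
    ∫ x in Ω, F x = ∑ σ, ∫ x in cell σ.1, G σ x := by
  rw [setIntegral_congr_set ae_eq_iUnion_cell, integral_iUnion_fintype]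
  · exact Finset.sum_congr rfl fun σ _ =>
      setIntegral_congr_fun (isOpen_cell _).measurableSet (hFG σ)
  · exact fun σ => (isOpen_cell _).measurableSet
  · exact fun σ τ h => T.disjoint _ σ.2 _ τ.2 fun h' => h (Subtype.ext h')
  · intro σ
    refine IntegrableOn.congr_fun ?_ (hFG σ).symm (isOpen_cell _).measurableSet
    exact ((hG σ).integrableOn_compact (isCompact_closedCell _)).mono_set
      (cell_subset_closedCell _)

lemma integral_interp_pos {η : E d → ℝ} (hη : ∀ i : T.nodes, 0 < η i) (σ : T.cells) :
    0 < ∫ x in cell σ.1, T.interp η x := by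
  have hpos : ∀ x ∈ cell σ.1, 0 < T.interp η x := by
    intro x hx
    rw [T.interp_eq η σ.2 (cell_subset_closedCell _ hx), localInterp_apply]
    rw [cell_eq_setOf_coord_pos] at hx
    exact Finset.sum_pos (fun k _ => mul_pos (hη (vertex σ k)) (hx k)) Finset.univ_nonempty
  have hint : IntegrableOn (T.interp η) (cell σ.1) :=
    (((T.interp_mem η).1.mono (T.closedCell_subset σ)).integrableOn_compact
      (isCompact_closedCell _)).mono_set (cell_subset_closedCell _)
  rw [setIntegral_pos_iff_support_of_nonneg_ae
    ((ae_restrict_mem (isOpen_cell _).measurableSet).mono fun x hx => (hpos x hx).le) hint]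
  have : Function.support (T.interp η) ∩ cell σ.1 = cell σ.1 :=
    inter_eq_right.2 fun x hx => (hpos x hx).ne'
  rw [this]
  exact (isOpen_cell _).measure_pos _ (cell_nonempty _)

end Mesh

/-! ### The boundary and the data -/

lemma AdmissibleBoundary.subset_closure {d : ℕ} {Ω D N : Set (E d)}
    (h : AdmissibleBoundary Ω D N) : D ⊆ closure Ω := by
  rcases h with ⟨rfl, -⟩ | ⟨-, rfl⟩ | ⟨H, hH, rfl, rfl, -⟩
  · exact frontier_subset_closure
  · exact empty_subset _
  · rintro x ⟨hx, -⟩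
    -- A point of the closed face is approached from inside the cube by shrinking it towards the
    -- origin.
    have hlim : Tendsto (fun t : ℝ => t • x) (𝓝[<] 1) (𝓝 x) := by
      have : Tendsto (fun t : ℝ => t • x) (𝓝 1) (𝓝 ((1 : ℝ) • x)) :=
        (continuous_id.smul continuous_const).tendsto 1
      rw [one_smul] at this
      exact this.mono_left nhdsWithin_le_nhds
    refine mem_closure_of_tendsto hlim ?_
    filter_upwards [Ioo_mem_nhdsLT (show (0 : ℝ) < 1 by norm_num)] with t ht i
    rw [PiLp.smul_apply, smul_eq_mul, abs_mul, abs_of_pos ht.1]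
    calc t * |x i| ≤ t * H := by gcongr; exacts [ht.1.le, hx i]
      _ < 1 * H := by gcongr; exact ht.2
      _ = H := one_mul H

/-- Unless the Dirichlet part is empty (pure Neumann conditions), it contains a point. -/
lemma AdmissibleBoundary.nonempty_or {d : ℕ} (hd : d ≠ 0) {Ω D N : Set (E d)} (hΩ : Ω.Nonempty)
    (hb : IsCompact (closure Ω)) (h : AdmissibleBoundary Ω D N) :
    D.Nonempty ∨ (D = ∅ ∧ N = frontier Ω) := by
  rcases h with ⟨rfl, -⟩ | ⟨hN, hD⟩ | ⟨H, hH, -, rfl, -⟩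
  · left
    have : NeZero d := ⟨hd⟩
    have : Nontrivial (E d) := inferInstance
    -- An empty frontier would force `Ω` to be the whole space, whose closure is not compact.
    refine nonempty_frontier_iff.2 ⟨hΩ, fun hu => ?_⟩
    rw [hu, closure_univ] at hb
    exact noncompact_univ (E d) hb
  · exact Or.inr ⟨hD, hN⟩
  · refine Or.inl ⟨WithLp.toLp 2 fun _ => H, fun i => (abs_of_pos hH).le, fun i _ => rfl⟩

/-- Ensures that the coupling constant is nonzero, so that the multiplier can be divided by it in
the Neumann case. -/
lemma cPsi_pos : 0 < cPsi := by
  have h : ∀ s ∈ Icc (-1 : ℝ) 1, √(2 * (obstaclePotential s).toReal) = √(1 - s ^ 2) := by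
    intro s hs
    have hs' : |s| ≤ 1 := abs_le.2 hs
    rw [obstaclePotential, if_pos hs', ENNReal.toReal_ofReal (by nlinarith [hs.1, hs.2])]
    congr 1
    ring
  rw [cPsi, intervalIntegral.integral_congr (g := fun s => √(1 - s ^ 2)) (by
    rw [uIcc_of_le (by norm_num)]; exact h)]
  refine intervalIntegral.intervalIntegral_pos_of_pos_on
    (Continuous.intervalIntegrable (by fun_prop) _ _) (fun s hs => ?_) (by norm_num)
  exact Real.sqrt_pos.2 (by nlinarith [hs.1, hs.2])

lemma Model.Admissible.b_pos {d L : ℕ} {M : Model d L} (hM : M.Admissible) {s : ℝ}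
    (hs : |s| ≤ 1) : 0 < M.b s := by
  have h1 := hM.Kplus_pos
  have h2 := hM.Kminus_pos
  rw [abs_le] at hs
  unfold Model.b
  rcases le_total 0 s with h | h
  · have : 0 ≤ (1 - s) / 2 * M.Kminus := mul_nonneg (by linarith [hs.2]) h2.le
    have : 0 < (1 + s) / 2 * M.Kplus := mul_pos (by linarith) h1
    linarith
  · have : 0 < (1 - s) / 2 * M.Kminus := mul_pos (by linarith [hs.2]) h2
    have : 0 ≤ (1 + s) / 2 * M.Kplus := mul_nonneg (by linarith) h1.le
    linarith

end ObstacleScheme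

/-! ### The scheme as an algebraic system for nodal values. -/

namespace ObstacleScheme

/-- For `r = 1` the matrix `B_r(q, p)` does not depend on `p`. -/
lemma Model.B_eq_of_r_eq_one {d L : ℕ} (M : Model d L) (hr : M.r = 1) (q p : E d) :
    M.B q p = M.B q 0 := by
  simp [Model.B, hr]

namespace Mesh

variable {d L : ℕ} {Ω D : Set (E d)} {T : Mesh Ω}

/-- The integral over a cell of the interpolated diffusivity. -/
def diffusivity (M : Model d L) (Φ₀ : E d → ℝ) (σ : T.cells) : ℝ :=
  ∫ x in cell σ.1, T.interp (fun y => M.b (Φ₀ y)) x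

lemma diffusivity_pos {M : Model d L} (hM : M.Admissible) {Φ₀ : E d → ℝ} (hΦ₀ : Φ₀ ∈ T.Kh)
    (σ : T.cells) : 0 < diffusivity M Φ₀ σ :=
  integral_interp_pos (fun i => hM.b_pos (abs_le_one_of_mem_Kh hΦ₀ (T.node_mem_closure i))) σ

/-- The scheme in terms of nodal values. -/
lemma isSolution_of_nodal {M : Model d L} (hM : M.Admissible) (hr : M.r = 1)
    (hD : D ⊆ closure Ω) {uD τ : ℝ} {Φ₀ W₀ : E d → ℝ} (hΦ₀ : Φ₀ ∈ T.Kh)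
    (hW₀ : 0 < M.vartheta → W₀ ∈ T.ShD D uD) {x w : T.nodes → ℝ}
    (hx : x ∈ Icc (-1 : T.nodes → ℝ) 1) (hw : ∀ y ∈ D, T.ofNodal w y = uD)
    (heat : ∀ χ : T.nodes → ℝ, (∀ y ∈ D, T.ofNodal χ y = 0) →
      M.vartheta * ∑ i, mass i * ((w i - W₀ i) / τ * χ i)
        + M.lam * ∑ i, mass i * (M.shapeHat (Φ₀ i) (x i) * ((x i - Φ₀ i) / τ) * χ i)
        + ∑ σ, diffusivity M Φ₀ σ * ((cellGrad σ w).ofLp ⬝ᵥ (cellGrad σ χ).ofLp) = 0)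
    (phase : ∀ χ ∈ Icc (-1 : T.nodes → ℝ) 1,
      ∑ i, mass i * ((cPsi * (M.a / M.alpha) * M.shapeHat (Φ₀ i) (x i) * w i
          + M.eps⁻¹ * Φ₀ i) * (χ i - x i))
        ≤ M.eps * (M.rho / M.alpha) * ∑ σ : T.cells, vertexWeight σ *
            ∑ k, M.mu (cellGrad σ fun i => Φ₀ i) *
              ((x (vertex σ k) - Φ₀ (vertex σ k)) / τ) * (χ (vertex σ k) - x (vertex σ k))
          + M.eps * ∑ σ : T.cells, (volume (cell σ.1)).toReal *
            ((M.B (cellGrad σ fun i => Φ₀ i) 0).mulVec (cellGrad σ x).ofLp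
              ⬝ᵥ (cellGrad σ (χ - x)).ofLp)) :
    IsSolution M T D uD τ Φ₀ W₀ (T.ofNodal x) (T.ofNodal w) := by
  have hxS := T.ofNodal_mem x
  have hwS := T.ofNodal_mem w
  have hxc := hxS.1
  have hwc := hwS.1
  have hΦc := hΦ₀.1.1
  have hxr : (fun i : T.nodes => T.ofNodal x i) = x := funext (T.ofNodal_node x)
  have hwr : (fun i : T.nodes => T.ofNodal w i) = w := funext (T.ofNodal_node w)
  have hshape : ContinuousOn (fun y => M.shapeHat (Φ₀ y) (T.ofNodal x y)) (closure Ω) :=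
    (hM.shapePlus_contDiff.continuous.comp_continuousOn hxS.1).add
      (hM.shapeMinus_contDiff.continuous.comp_continuousOn hΦ₀.1.1)
  have hconst : ∀ y ∈ closure Ω, T.interp (fun _ => uD) y = uD := by
    intro y hy
    obtain ⟨σ, hσ⟩ := T.exists_mem_closedCell hy
    rw [T.interp_eq _ σ.2 hσ, localInterp_apply, ← Finset.mul_sum,
      (vertexBasis σ.1).sum_coord_apply_eq_one, mul_one]
  refine ⟨ofNodal_mem_Kh hx, ⟨hwS, fun y hy => by rw [hw y hy, hconst y (hD hy)]⟩, ?_, ?_⟩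
  · intro χ hχ
    have hχc := hχ.1.1
    have h := heat (fun i => χ i) fun y hy => by rw [← eq_ofNodal hχ.1 (hD hy), hχ.2 y hy]
    have e1 : M.vartheta * T.lumped (fun y => (T.ofNodal w y - W₀ y) / τ) χ
        = M.vartheta * ∑ i : T.nodes, mass i * ((w i - W₀ i) / τ * χ i) := by
      -- Nothing is known about `W₀` when `ϑ = 0`, but then the factor removes the term.
      rcases hM.vartheta_nonneg.eq_or_lt with h0 | h0
      · simp [← h0]
      · have hWc := (hW₀ h0).1.1
        rw [lumped_eq_sum_mass ?_ hχc]
        · simp only [ofNodal_node]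
        · fun_prop
    have e2 : T.lumped (fun y => M.shapeHat (Φ₀ y) (T.ofNodal x y) * ((T.ofNodal x y - Φ₀ y) / τ)) χ
        = ∑ i : T.nodes, mass i * (M.shapeHat (Φ₀ i) (x i) * ((x i - Φ₀ i) / τ) * χ i) := by
      rw [lumped_eq_sum_mass ?_ hχc]
      · simp only [ofNodal_node]
      · fun_prop
    have e3 : ∫ y in Ω, T.interp (fun z => M.b (Φ₀ z)) y *
          ((∇ (T.ofNodal w) y).ofLp ⬝ᵥ (∇ χ y).ofLp)
        = ∑ σ : T.cells, diffusivity M Φ₀ σ *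
          ((cellGrad σ w).ofLp ⬝ᵥ (cellGrad σ fun i => χ i).ofLp) := by
      rw [setIntegral_eq_sum (T := T) (G := fun σ y => T.interp (fun z => M.b (Φ₀ z)) y *
          ((cellGrad σ w).ofLp ⬝ᵥ (cellGrad σ fun i => χ i).ofLp))]
      · exact Finset.sum_congr rfl fun σ _ => integral_mul_const _ _
      · intro σ y hy
        dsimp only
        rw [gradient_eq_cellGrad hwS σ hy, gradient_eq_cellGrad hχ.1 σ hy, hwr]
      · exact fun σ => ((T.interp_mem _).1.mono (T.closedCell_subset σ)).mul continuousOn_const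
    rw [e1, e2, e3]
    exact h
  · intro χ hχ
    have hχc := hχ.1.1
    have h := phase (fun i => χ i) (nodal_mem_Icc hχ)
    have e1 : T.lumped (fun y => cPsi * (M.a / M.alpha) * M.shapeHat (Φ₀ y) (T.ofNodal x y)
          * T.ofNodal w y + M.eps⁻¹ * Φ₀ y) (fun y => χ y - T.ofNodal x y)
        = ∑ i : T.nodes, mass i * ((cPsi * (M.a / M.alpha) * M.shapeHat (Φ₀ i) (x i) * w i
          + M.eps⁻¹ * Φ₀ i) * (χ i - x i)) := by
      rw [lumped_eq_sum_mass]
      · simp only [ofNodal_node]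
      · fun_prop
      · fun_prop
    have e2 : T.lumped (fun y => M.mu (∇ Φ₀ y) * ((T.ofNodal x y - Φ₀ y) / τ))
          (fun y => χ y - T.ofNodal x y)
        = ∑ σ : T.cells, vertexWeight σ * ∑ k, M.mu (cellGrad σ fun i => Φ₀ i) *
              ((x (vertex σ k) - Φ₀ (vertex σ k)) / τ) * (χ (vertex σ k) - x (vertex σ k)) := by
      -- The coefficient `μ(∇Φ₀)` jumps between cells, so the sum stays cellwise instead of being
      -- collected into nodal masses.
      refine lumped_eq_sum fun σ k => ?_
      have h1 := tendsto_vertex ((hxS.1.sub hΦ₀.1.1).div_const τ) σ k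
      have h2 := tendsto_vertex (hχ.1.1.sub hxS.1) σ k
      have h3 := (h1.const_mul (M.mu (cellGrad σ fun i => Φ₀ i))).mul h2
      simp only [Pi.sub_apply, ofNodal_node] at h3
      refine h3.congr' ?_
      filter_upwards [self_mem_nhdsWithin] with y hy
      rw [gradient_eq_cellGrad hΦ₀.1 σ hy]
    have e3 : ∫ y in Ω, (M.B (∇ Φ₀ y) (∇ (T.ofNodal x) y)).mulVec (∇ (T.ofNodal x) y).ofLp
            ⬝ᵥ (∇ (fun z => χ z - T.ofNodal x z) y).ofLp
        = ∑ σ : T.cells, (volume (cell σ.1)).toReal *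
            ((M.B (cellGrad σ fun i => Φ₀ i) 0).mulVec (cellGrad σ x).ofLp
              ⬝ᵥ (cellGrad σ ((fun i : T.nodes => χ i) - x)).ofLp) := by
      rw [setIntegral_eq_sum (T := T) (G := fun σ _ =>
        (M.B (cellGrad σ fun i => Φ₀ i) 0).mulVec (cellGrad σ x).ofLp
              ⬝ᵥ (cellGrad σ ((fun i : T.nodes => χ i) - x)).ofLp)]
      · refine Finset.sum_congr rfl fun σ _ => ?_
        rw [setIntegral_const, smul_eq_mul]
        rfl
      · intro σ y hy
        have hsub : (fun i : T.nodes => χ i - T.ofNodal x i) = (fun i : T.nodes => χ i) - x := by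
          ext i; simp
        dsimp only
        rw [gradient_eq_cellGrad (sub_mem_Sh hχ.1 hxS) σ hy, gradient_eq_cellGrad hΦ₀.1 σ hy,
          gradient_eq_cellGrad hxS σ hy, hxr, M.B_eq_of_r_eq_one hr, hsub]
      · exact fun σ => continuousOn_const
    rw [e1, e2, e3]
    exact h

/-- The bilinear form of the discrete heat equation. -/
def heatForm (T : Mesh Ω) (θ : ℝ) (β : T.cells → ℝ) :
    (T.nodes → ℝ) →ₗ[ℝ] (T.nodes → ℝ) →ₗ[ℝ] ℝ :=
  LinearMap.mk₂ ℝ (fun v χ => θ * ∑ i, mass i * (v i * χ i)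
      + ∑ σ, β σ * ((cellGrad σ v).ofLp ⬝ᵥ (cellGrad σ χ).ofLp))
    (fun v v' χ => by
      simp only [Pi.add_apply, map_add, WithLp.ofLp_add, add_dotProduct, add_mul, mul_add,
        Finset.sum_add_distrib]
      ring)
    (fun c v χ => by
      simp only [Pi.smul_apply, map_smul, WithLp.ofLp_smul, smul_dotProduct, smul_eq_mul, mul_add,
        Finset.mul_sum]
      congr 1 <;> refine Finset.sum_congr rfl fun _ _ => ?_ <;> ring)
    (fun v χ χ' => by
      simp only [Pi.add_apply, map_add, WithLp.ofLp_add, dotProduct_add, mul_add,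
        Finset.sum_add_distrib]
      ring)
    (fun c v χ => by
      simp only [Pi.smul_apply, map_smul, WithLp.ofLp_smul, dotProduct_smul, smul_eq_mul, mul_add,
        Finset.mul_sum]
      congr 1 <;> refine Finset.sum_congr rfl fun _ _ => ?_ <;> ring)

lemma heatForm_apply (θ : ℝ) (β : T.cells → ℝ) (v χ : T.nodes → ℝ) :
    T.heatForm θ β v χ = θ * ∑ i, mass i * (v i * χ i)
      + ∑ σ, β σ * ((cellGrad σ v).ofLp ⬝ᵥ (cellGrad σ χ).ofLp) := rfl

lemma dotProduct_ofLp_self_nonneg (p : E d) : 0 ≤ p.ofLp ⬝ᵥ p.ofLp :=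
  Finset.sum_nonneg fun _ _ => mul_self_nonneg _

lemma heatForm_self_nonneg {θ : ℝ} (hθ : 0 ≤ θ) {β : T.cells → ℝ} (hβ : ∀ σ, 0 < β σ)
    (v : T.nodes → ℝ) : 0 ≤ T.heatForm θ β v v :=
  add_nonneg (mul_nonneg hθ (Finset.sum_nonneg fun i _ =>
      mul_nonneg (mass_pos i).le (mul_self_nonneg _)))
    (Finset.sum_nonneg fun σ _ => mul_nonneg (hβ σ).le (dotProduct_ofLp_self_nonneg _))

/-- Mass part and gradient part are both nonnegative, so each vanishes. These are the two sources of
definiteness: a positive `θ`, or constancy combined with a Dirichlet condition. -/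
lemma heatForm_self_eq_zero {θ : ℝ} (hθ : 0 ≤ θ) {β : T.cells → ℝ} (hβ : ∀ σ, 0 < β σ)
    {v : T.nodes → ℝ} (h : T.heatForm θ β v v = 0) :
    (0 < θ → v = 0) ∧ ∀ σ : T.cells, cellGrad σ v = 0 := by
  have n1 : ∀ i ∈ Finset.univ, 0 ≤ mass i * (v i * v i) := fun i _ =>
    mul_nonneg (mass_pos i).le (mul_self_nonneg _)
  have n2 : ∀ σ ∈ Finset.univ, 0 ≤ β σ * ((cellGrad σ v).ofLp ⬝ᵥ (cellGrad σ v).ofLp) :=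
    fun σ _ => mul_nonneg (hβ σ).le (dotProduct_ofLp_self_nonneg _)
  obtain ⟨h1, h2⟩ := (add_eq_zero_iff_of_nonneg (mul_nonneg hθ (Finset.sum_nonneg n1))
    (Finset.sum_nonneg n2)).1 h
  refine ⟨fun h0 => ?_, fun σ => ?_⟩
  · have h3 := (Finset.sum_eq_zero_iff_of_nonneg n1).1 ((mul_eq_zero.1 h1).resolve_left h0.ne')
    ext i
    exact mul_self_eq_zero.1 ((mul_eq_zero.1 (h3 i (Finset.mem_univ i))).resolve_left
      (mass_pos i).ne')
  · have h3 := (Finset.sum_eq_zero_iff_of_nonneg n2).1 h2 σ (Finset.mem_univ σ)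
    have h4 := (mul_eq_zero.1 h3).resolve_left (hβ σ).ne'
    exact (WithLp.ofLp_eq_zero 2).1 (dotProduct_self_eq_zero.1 h4)

/-- The bilinear form of the discrete phase field inequality; `m` and `B` are the mobility
coefficient and the diffusion matrix on the cells. -/
def phaseForm (T : Mesh Ω) (m : T.cells → ℝ) (B : T.cells → Matrix (Fin d) (Fin d) ℝ) :
    (T.nodes → ℝ) →ₗ[ℝ] (T.nodes → ℝ) →ₗ[ℝ] ℝ :=
  LinearMap.mk₂ ℝ (fun v χ =>
      ∑ σ, vertexWeight σ * ∑ k, m σ * v (vertex σ k) * χ (vertex σ k)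
      + ∑ σ, (volume (cell σ.1)).toReal *
        ((B σ).mulVec (cellGrad σ v).ofLp ⬝ᵥ (cellGrad σ χ).ofLp))
    (fun v v' χ => by
      simp only [Pi.add_apply, map_add, WithLp.ofLp_add, Matrix.mulVec_add, add_dotProduct,
        add_mul, mul_add, Finset.sum_add_distrib]
      ring)
    (fun c v χ => by
      simp only [Pi.smul_apply, map_smul, WithLp.ofLp_smul, Matrix.mulVec_smul, smul_dotProduct,
        smul_eq_mul, mul_add, Finset.mul_sum]
      congr 1
      · refine Finset.sum_congr rfl fun _ _ => Finset.sum_congr rfl fun _ _ => ?_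
        ring
      · refine Finset.sum_congr rfl fun _ _ => ?_
        ring)
    (fun v χ χ' => by
      simp only [Pi.add_apply, map_add, WithLp.ofLp_add, dotProduct_add, mul_add,
        Finset.sum_add_distrib]
      ring)
    (fun c v χ => by
      simp only [Pi.smul_apply, map_smul, WithLp.ofLp_smul, dotProduct_smul, smul_eq_mul, mul_add,
        Finset.mul_sum]
      congr 1
      · refine Finset.sum_congr rfl fun _ _ => Finset.sum_congr rfl fun _ _ => ?_
        ring
      · refine Finset.sum_congr rfl fun _ _ => ?_
        ring)

lemma phaseForm_apply (m : T.cells → ℝ) (B : T.cells → Matrix (Fin d) (Fin d) ℝ)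
    (v χ : T.nodes → ℝ) : T.phaseForm m B v χ =
      ∑ σ, vertexWeight σ * ∑ k, m σ * v (vertex σ k) * χ (vertex σ k)
      + ∑ σ, (volume (cell σ.1)).toReal *
        ((B σ).mulVec (cellGrad σ v).ofLp ⬝ᵥ (cellGrad σ χ).ofLp) := rfl

/-- The nodal values of the functions that vanish on the Dirichlet boundary. -/
def dirichletSubmodule (T : Mesh Ω) (hD : D ⊆ closure Ω) : Submodule ℝ (T.nodes → ℝ) where
  carrier := {v | ∀ y ∈ D, T.ofNodal v y = 0}
  add_mem' {v v'} hv hv' y hy := by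
    obtain ⟨σ, hσ⟩ := T.exists_mem_closedCell (hD hy)
    have h1 := hv y hy
    have h2 := hv' y hy
    rw [ofNodal_apply _ σ hσ] at h1 h2 ⊢
    simp only [Pi.add_apply, add_mul, Finset.sum_add_distrib, h1, h2, add_zero]
  zero_mem' y hy := by
    obtain ⟨σ, hσ⟩ := T.exists_mem_closedCell (hD hy)
    simp [ofNodal_apply _ σ hσ]
  smul_mem' c v hv y hy := by
    obtain ⟨σ, hσ⟩ := T.exists_mem_closedCell (hD hy)
    have h1 := hv y hy
    rw [ofNodal_apply _ σ hσ] at h1 ⊢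
    simp only [Pi.smul_apply, smul_eq_mul, mul_assoc, ← Finset.mul_sum, h1, mul_zero]

/-- Used to lift the constant Dirichlet datum: the unknown becomes `w = W - u_D`, which ranges over
a linear space. -/
lemma ofNodal_const_add (c : ℝ) (v : T.nodes → ℝ) {y : E d} (hy : y ∈ closure Ω) :
    T.ofNodal (fun i => c + v i) y = c + T.ofNodal v y := by
  obtain ⟨σ, hσ⟩ := T.exists_mem_closedCell hy
  rw [ofNodal_apply _ σ hσ, ofNodal_apply _ σ hσ]
  simp only [add_mul, Finset.sum_add_distrib, ← Finset.mul_sum,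
    (vertexBasis σ.1).sum_coord_apply_eq_one, mul_one]

end Mesh

end ObstacleScheme

/-! ### Operator form and existence in the definite and the pure Neumann case. -/

namespace ObstacleScheme

namespace Mesh

variable {d L : ℕ} {Ω D : Set (E d)} {T : Mesh Ω}

/-- The bilinear part of the discrete phase field inequality. -/
def phaseOperator (M : Model d L) (T : Mesh Ω) (τ : ℝ) (Φ₀ : E d → ℝ) :
    (T.nodes → ℝ) →ₗ[ℝ] (T.nodes → ℝ) →ₗ[ℝ] ℝ :=
  T.phaseForm (fun σ => M.eps * (M.rho / M.alpha) * M.mu (cellGrad σ fun i => Φ₀ i) / τ)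
    fun σ => M.eps • M.B (cellGrad σ fun i => Φ₀ i) 0

/-- The linear part of the discrete phase field inequality. -/
def phaseLoad (M : Model d L) (T : Mesh Ω) (τ : ℝ) (Φ₀ : E d → ℝ) : (T.nodes → ℝ) →ₗ[ℝ] ℝ :=
  -T.phaseForm (fun σ => M.eps * (M.rho / M.alpha) * M.mu (cellGrad σ fun i => Φ₀ i) / τ)
      (fun _ => 0) (fun i => Φ₀ i)
    - ∑ i : T.nodes, (mass i * (M.eps⁻¹ * Φ₀ i)) • LinearMap.proj i

/-- Splits the inequality into a part bilinear in the new phase and the test direction, and a load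
from the old phase. The load includes the explicit term `ε⁻¹ Φ₀`, brought over from the other side.
-/
lemma phaseOperator_add_phaseLoad (M : Model d L) (τ : ℝ) (Φ₀ : E d → ℝ) (x v : T.nodes → ℝ) :
    phaseOperator M T τ Φ₀ x v + phaseLoad M T τ Φ₀ v
        + ∑ i : T.nodes, mass i * (M.eps⁻¹ * Φ₀ i * v i)
      = M.eps * (M.rho / M.alpha) * ∑ σ : T.cells, vertexWeight σ *
            ∑ k, M.mu (cellGrad σ fun i => Φ₀ i) *
              ((x (vertex σ k) - Φ₀ (vertex σ k)) / τ) * v (vertex σ k)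
          + M.eps * ∑ σ : T.cells, (volume (cell σ.1)).toReal *
            ((M.B (cellGrad σ fun i => Φ₀ i) 0).mulVec (cellGrad σ x).ofLp
              ⬝ᵥ (cellGrad σ v).ofLp) := by
  have e1 : ∑ i : T.nodes, mass i * (M.eps⁻¹ * Φ₀ i * v i)
      = ∑ i : T.nodes, mass i * (M.eps⁻¹ * Φ₀ i) * v i :=
    Finset.sum_congr rfl fun i _ => by ring
  have e2 : M.eps * (M.rho / M.alpha) * ∑ σ : T.cells, vertexWeight σ *
        ∑ k, M.mu (cellGrad σ fun i => Φ₀ i) *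
          ((x (vertex σ k) - Φ₀ (vertex σ k)) / τ) * v (vertex σ k)
      = ∑ σ : T.cells, vertexWeight σ *
          ∑ k, M.eps * (M.rho / M.alpha) * M.mu (cellGrad σ fun i => Φ₀ i) / τ
            * x (vertex σ k) * v (vertex σ k)
        - ∑ σ : T.cells, vertexWeight σ *
          ∑ k, M.eps * (M.rho / M.alpha) * M.mu (cellGrad σ fun i => Φ₀ i) / τ
            * Φ₀ (vertex σ k) * v (vertex σ k) := by
    simp only [Finset.mul_sum, ← Finset.sum_sub_distrib]
    refine Finset.sum_congr rfl fun σ _ => Finset.sum_congr rfl fun k _ => ?_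
    ring
  have e3 : M.eps * ∑ σ : T.cells, (volume (cell σ.1)).toReal *
        ((M.B (cellGrad σ fun i => Φ₀ i) 0).mulVec (cellGrad σ x).ofLp ⬝ᵥ (cellGrad σ v).ofLp)
      = ∑ σ : T.cells, (volume (cell σ.1)).toReal *
        ((M.eps • M.B (cellGrad σ fun i => Φ₀ i) 0).mulVec (cellGrad σ x).ofLp
          ⬝ᵥ (cellGrad σ v).ofLp) := by
    rw [Finset.mul_sum]
    refine Finset.sum_congr rfl fun σ _ => ?_
    rw [Matrix.smul_mulVec, smul_dotProduct, smul_eq_mul]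
    ring
  rw [e1, e2, e3, phaseOperator, phaseLoad, LinearMap.sub_apply, LinearMap.neg_apply,
    phaseForm_apply, phaseForm_apply]
  simp only [Matrix.zero_mulVec, zero_dotProduct, mul_zero, Finset.sum_const_zero, add_zero,
    LinearMap.sum_apply, LinearMap.smul_apply, LinearMap.proj_apply, smul_eq_mul]
  ring

/-- The scheme with the phase field inequality in operator form. -/
lemma isSolution_of_operator_form {M : Model d L} (hM : M.Admissible) (hr : M.r = 1)
    (hD : D ⊆ closure Ω) {uD τ : ℝ} {Φ₀ W₀ : E d → ℝ} (hΦ₀ : Φ₀ ∈ T.Kh)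
    (hW₀ : 0 < M.vartheta → W₀ ∈ T.ShD D uD) {x w : T.nodes → ℝ}
    (hx : x ∈ Icc (-1 : T.nodes → ℝ) 1) (hw : ∀ y ∈ D, T.ofNodal w y = 0)
    (heat : ∀ χ : T.nodes → ℝ, (∀ y ∈ D, T.ofNodal χ y = 0) →
      T.heatForm (M.vartheta / τ) (diffusivity M Φ₀) w χ
        + ∑ i, M.vartheta * (mass i * ((uD - W₀ i) / τ)) * χ i
        + ∑ i, M.lam * (mass i * (M.shapeHat (Φ₀ i) (x i) * ((x i - Φ₀ i) / τ))) * χ i = 0)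
    (phase : ∀ χ ∈ Icc (-1 : T.nodes → ℝ) 1,
      ∑ i, mass i * (cPsi * (M.a / M.alpha) * M.shapeHat (Φ₀ i) (x i)) * (uD + w i)
          * (χ i - x i)
        ≤ phaseOperator M T τ Φ₀ x (χ - x) + phaseLoad M T τ Φ₀ (χ - x)) :
    IsSolution M T D uD τ Φ₀ W₀ (T.ofNodal x) (T.ofNodal fun i => uD + w i) := by
  refine isSolution_of_nodal hM hr hD hΦ₀ hW₀ hx
    (fun y hy => by rw [ofNodal_const_add _ _ (hD hy), hw y hy, add_zero]) (fun χ hχ => ?_)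
    fun χ hχ => ?_
  · rw [← heat χ hχ, heatForm_apply]
    have e1 : ∀ σ : T.cells, cellGrad σ (fun i => uD + w i) = cellGrad σ w := by
      intro σ
      have : (fun i => uD + w i) = (fun _ => uD) + w := rfl
      rw [this, map_add, cellGrad_const, zero_add]
    have e2 : M.vartheta * ∑ i : T.nodes, mass i * ((uD + w i - W₀ i) / τ * χ i)
        = M.vartheta / τ * ∑ i : T.nodes, mass i * (w i * χ i)
          + ∑ i : T.nodes, M.vartheta * (mass i * ((uD - W₀ i) / τ)) * χ i := by
      simp only [Finset.mul_sum, ← Finset.sum_add_distrib]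
      refine Finset.sum_congr rfl fun i _ => ?_
      ring
    have e3 : M.lam * ∑ i : T.nodes,
          mass i * (M.shapeHat (Φ₀ i) (x i) * ((x i - Φ₀ i) / τ) * χ i)
        = ∑ i : T.nodes,
          M.lam * (mass i * (M.shapeHat (Φ₀ i) (x i) * ((x i - Φ₀ i) / τ))) * χ i := by
      rw [Finset.mul_sum]
      refine Finset.sum_congr rfl fun i _ => ?_
      ring
    simp only [e1]
    rw [e2, e3]
    ring
  · have h1 := phase χ hχ
    have h2 := phaseOperator_add_phaseLoad M τ Φ₀ x (χ - x)
    simp only [Pi.sub_apply] at h2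
    rw [← h2]
    have e : ∑ i : T.nodes, mass i * ((cPsi * (M.a / M.alpha) * M.shapeHat (Φ₀ i) (x i)
          * (uD + w i) + M.eps⁻¹ * Φ₀ i) * (χ i - x i))
        = ∑ i : T.nodes, mass i * (cPsi * (M.a / M.alpha) * M.shapeHat (Φ₀ i) (x i))
            * (uD + w i) * (χ i - x i)
          + ∑ i : T.nodes, mass i * (M.eps⁻¹ * Φ₀ i * (χ i - x i)) := by
      rw [← Finset.sum_add_distrib]
      refine Finset.sum_congr rfl fun i _ => ?_
      ring
    rw [e]
    linarith

lemma Icc_cube_nonempty {ι : Type*} : (Icc (-1 : ι → ℝ) 1).Nonempty :=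
  ⟨0, fun _ => by simp, fun _ => by simp⟩

/-- Existence if the discrete heat operator is definite. -/
lemma exists_isSolution_of_definite (hΩ : IsConnected Ω) {M : Model d L} (hM : M.Admissible)
    (hr : M.r = 1) (hD : D ⊆ closure Ω) {uD τ : ℝ} (hτ : 0 < τ) {Φ₀ W₀ : E d → ℝ}
    (hΦ₀ : Φ₀ ∈ T.Kh) (hW₀ : 0 < M.vartheta → W₀ ∈ T.ShD D uD)
    (h : 0 < M.vartheta ∨ D.Nonempty) :
    ∃ Φ W : E d → ℝ, IsSolution M T D uD τ Φ₀ W₀ Φ W := by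
  have hβ := diffusivity_pos hM hΦ₀
  have hs : ∀ s, Continuous fun y => M.shapeHat s y := fun s =>
    hM.shapePlus_contDiff.continuous.add continuous_const
  obtain ⟨x, hx, w, hw, h1, h2⟩ := FixedPoint.exists_coupled_solution
    (isCompact_Icc (a := (-1 : T.nodes → ℝ)) (b := 1)) (convex_Icc _ _) Icc_cube_nonempty
    (T.dirichletSubmodule hD) (T.heatForm (M.vartheta / τ) (diffusivity M Φ₀))
    (phaseOperator M T τ Φ₀) (fun v hv h0 => by
      obtain ⟨h3, h4⟩ := heatForm_self_eq_zero (div_nonneg hM.vartheta_nonneg hτ.le) hβ h0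
      -- Either the mass term forces `v = 0`, or `v` is a constant that vanishes at a Dirichlet
      -- point.
      rcases h with h | ⟨y, hy⟩
      · exact h3 (div_pos h hτ)
      · obtain ⟨c, rfl⟩ := exists_const_of_cellGrad_eq_zero hΩ h4
        have h5 : T.ofNodal (fun _ => c) y = 0 := hv y hy
        obtain ⟨σ, hσ⟩ := T.exists_mem_closedCell (hD hy)
        rw [ofNodal_apply _ σ hσ, ← Finset.mul_sum,
          (vertexBasis σ.1).sum_coord_apply_eq_one, mul_one] at h5
        rw [h5]
        rfl)
    (fun _ => uD) (∑ i : T.nodes, (M.vartheta * (mass i * ((uD - W₀ i) / τ))) • LinearMap.proj i)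
    (phaseLoad M T τ Φ₀)
    (g := fun i y => M.lam * (mass i * (M.shapeHat (Φ₀ i) y * ((y - Φ₀ i) / τ))))
    (h := fun i y => mass i * (cPsi * (M.a / M.alpha) * M.shapeHat (Φ₀ i) y))
    (fun i => by have := hs (Φ₀ i); fun_prop) (fun i => by have := hs (Φ₀ i); fun_prop)
  refine ⟨_, _, isSolution_of_operator_form hM hr hD hΦ₀ hW₀ hx hw (fun χ hχ => ?_) h2⟩
  have := h1 χ hχ
  simpa only [LinearMap.sum_apply, LinearMap.smul_apply, LinearMap.proj_apply, smul_eq_mul]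
    using this

/-- Existence for pure Neumann conditions without the time derivative of `w`, for an explicit shape
function. -/
lemma exists_isSolution_of_neumann (hΩ : IsConnected Ω) {M : Model d L} (hM : M.Admissible)
    (hr : M.r = 1) {uD τ : ℝ} {Φ₀ W₀ : E d → ℝ} (hΦ₀ : Φ₀ ∈ T.Kh)
    (hθ : M.vartheta = 0) (hs : ∀ s, M.shapePlus s = 0) :
    ∃ Φ W : E d → ℝ, IsSolution M T ∅ uD τ Φ₀ W₀ Φ W := by
  have hβ := diffusivity_pos hM hΦ₀
  -- The weights no longer involve the new phase, so the solvability constraint is linear in it;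
  -- they are nonnegative because `ϱ ≥ 0` on `[-1, 1]`.
  have hshape : ∀ i y, M.shapeHat (Φ₀ i) y = M.shape (Φ₀ i) := fun i y => by
    simp [Model.shapeHat, Model.shape, hs]
  obtain ⟨x, hx, w, h1, h2⟩ := FixedPoint.exists_coupled_solution_of_constants
    (T.heatForm 0 (diffusivity M Φ₀)) (phaseOperator M T τ Φ₀)
    (heatForm_self_nonneg le_rfl hβ)
    (fun v hv => exists_const_of_cellGrad_eq_zero hΩ (heatForm_self_eq_zero le_rfl hβ hv).2)
    (fun v c => by simp [heatForm_apply, cellGrad_const])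
    (fun v c => by simp [heatForm_apply, cellGrad_const])
    (phaseLoad M T τ Φ₀) (nodal_mem_Icc hΦ₀) (ω := fun i => mass i * M.shape (Φ₀ i))
    (fun i => mul_nonneg (mass_pos i).le (hM.shape_nonneg _
      ⟨(nodal_mem_Icc hΦ₀).1 i, (nodal_mem_Icc hΦ₀).2 i⟩))
    (M.lam / τ) (c := cPsi * (M.a / M.alpha))
    (mul_pos cPsi_pos (div_pos hM.a_pos hM.alpha_pos)).ne'
  -- The operator form writes the temperature as `uD + w`; subtracting `uD` compensates and leaves
  -- the gradients unchanged.
  have hA : ∀ χ, T.heatForm 0 (diffusivity M Φ₀) (fun i => w i - uD) χ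
      = T.heatForm 0 (diffusivity M Φ₀) w χ := by
    intro χ
    have e : (fun i => w i - uD) = w - fun _ => uD := rfl
    simp [heatForm_apply, e, cellGrad_const]
  refine ⟨_, _, isSolution_of_operator_form (w := fun i => w i - uD) hM hr (empty_subset _) hΦ₀
    (fun h => absurd hθ h.ne') hx (by simp) (fun χ _ => ?_) fun χ hχ => ?_⟩
  · rw [hθ, zero_div, hA]
    simp only [zero_mul, Finset.sum_const_zero, add_zero, hshape]
    refine Eq.trans ?_ (h1 χ)
    congr 1
    refine Finset.sum_congr rfl fun i _ => ?_
    ring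
  · refine le_trans (le_of_eq ?_) (h2 χ hχ)
    refine Finset.sum_congr rfl fun i _ => ?_
    rw [hshape]
    ring

end Mesh

end ObstacleScheme

end

theorem theorem3p3 {d L : ℕ} (hd : d = 2 ∨ d = 3)
    (Ω D N : Set (ObstacleScheme.E d)) (hΩ : IsOpen Ω) (hΩc : IsConnected Ω)
    (hDN : ObstacleScheme.AdmissibleBoundary Ω D N)
    (T : ObstacleScheme.Mesh Ω)
    (M : ObstacleScheme.Model d L) (hM : M.Admissible) (hr : M.r = 1)
    (uD τ : ℝ) (hτ : 0 < τ)
    (Φ₀ W₀ : ObstacleScheme.E d → ℝ) (hΦ₀ : Φ₀ ∈ T.Kh)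
    (hW₀ : 0 < M.vartheta → W₀ ∈ T.ShD D uD)
    (hnd : 0 < M.rho + |∫ x in Ω, Φ₀ x| ∨
      ∀ χ ∈ T.Kh, 0 < T.lumped (fun x => |M.shapeHat (Φ₀ x) (χ x)|) (fun _ => 1))
    (hbc : (∀ s, M.shapePlus s = 0) ∨ 0 < M.vartheta ∨ N ≠ frontier Ω) :
    ∃ Φ W : ObstacleScheme.E d → ℝ,
      ObstacleScheme.IsSolution M T D uD τ Φ₀ W₀ Φ W := by

  have hD := hDN.subset_closure
  by_cases h : 0 < M.vartheta ∨ D.Nonempty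
  · exact ObstacleScheme.Mesh.exists_isSolution_of_definite hΩc hM hr hD hτ hΦ₀ hW₀ h
  · rw [not_or] at h
    -- An empty Dirichlet part means pure Neumann conditions, so of the three alternatives in `hbc`
    -- only `ϱ⁺ = 0` remains.
    obtain ⟨rfl, hN⟩ := (hDN.nonempty_or (by rcases hd with rfl | rfl <;> norm_num) hΩc.nonempty
      T.isCompact_closure).resolve_left h.2
    have hs := hbc.resolve_right (not_or.2 ⟨h.1, not_not.2 hN⟩)
    exact ObstacleScheme.Mesh.exists_isSolution_of_neumann hΩc hM hr hΦ₀
      (le_antisymm (not_lt.1 h.1) hM.vartheta_nonneg) hs
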